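/- **Theorem 1.3.** Work with formal power series in $q$ whose coefficients are Laurent polynomials in $\zeta$. For an integer $a$ put $$\mathcal C(az;\tau)=\prod_{n\ge 1}\frac{1-q^n}{(1-\zeta^{a}q^n)(1-\zeta^{-a}q^n)} .$$ Let $k\ge 1$ be an integer, let $\delta_{\mathrm{odd}}(k)$ be $1$ if $k$ is odd and $0$ if $k$ is even, and put $m=\frac{k+\delta_{\mathrm{odd}}(k)}{2}$. Define integers $a_1>a_2>\dots>a_m>0$ by $a_i=k-2(i-1)$, that is, $(a_1,\dots,a_m)=(k,\,k-2,\,k-4,\,\dots,\,2-\delta_{\mathrm{odd}}(k))$, except that $a_1=k$ is replaced by $a_1=k+2$ if $k+14$ is divisible by an odd prime $p\equiv 2\pmod 3$. The $k$-colored crank generating function is $$\mathcal C_k(z;\tau)=\mathcal C(0;\tau)^{\frac{k-\delta_{\mathrm{odd}}(k)}{2}}\prod_{i=1}^{m}\mathcal C(a_iz;\tau)=\prod_{n\ge1}\frac{1-\delta_{\mathrm{odd}}(k)q^n}{\prod_{i=1}^{m}(1-\zeta^{a_i}q^n)(1-\zeta^{-a_i}q^n)} .$$ Let $\ell\ge 5$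 be a prime and $h,t$ positive integers with $k+h=\ell t$ such that one of the following holds: 1. $h\in\{4,8,14\}$ and $\ell\equiv2\pmod 3$; 2. $h\in\{6,10\}$ and $\ell\equiv 3\pmod 4$; 3. $h=26$ and $\ell\equiv 11\pmod{12}$. Let $\delta\ge 0$ be an integer with $24\delta\equiv k\pmod \ell$. Suppose that the progression $\{\ell n+\delta\}_{n\ge 0}$ is generic, that is, neither of the following holds: - (i) some odd prime $p\equiv 2\pmod 3$ divides $k+14$, and $\ell\equiv 2\pmod 3$ and $\ell\mid k+8$; - (ii) $\ell\equiv 11\pmod{12}$ and $\ell\mid k+26$. Then for every $n\ge 0$ the $\ell$-th cyclotomic polynomial $\Phi_\ell(\zeta)$ divides the coefficient $[q^{\ell n+\delta}]\,\mathcal C_k(z;\tau)$ in $\mathbb Z[\zeta,\zeta^{-1}]$ (hence also in $\mathbb Q[\zeta,\zeta^{-1}]$). -/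

import Mathlib

/-!  Generating functions in `q` (the variable `PowerSeries.X`) are formal power series whose
coefficients are Laurent polynomials in `ζ` with integer coefficients; `ζ ^ a` is
`LaurentPolynomial.T a`. -/

/-- The factor `(1 - q^n) / ((1 - ζ^a q^n) (1 - ζ^(-a) q^n))`, for `n ≥ 1`. The denominator has
constant term `1`, so `PowerSeries.invOfUnit _ 1` is its inverse (see `crankFactor_mul`). -/
noncomputable def crankFactor (a : ℤ) (n : ℕ) : PowerSeries (LaurentPolynomial ℤ) :=
  (1 - PowerSeries.X ^ n) *
    PowerSeries.invOfUnit
      ((1 - PowerSeries.C (LaurentPolynomial.T a) * PowerSeries.X ^ n) *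
        (1 - PowerSeries.C (LaurentPolynomial.T (-a)) * PowerSeries.X ^ n)) 1

/-- The crank generating function `𝒞(a z; τ) = ∏_{n ≥ 1} (1 - q^n) / ((1 - ζ^a q^n)(1 - ζ^(-a) q^n))`.
The factor with index `n` is `1` modulo `q^n`, so the coefficient of `q^N` in the infinite product is
the one in the product of the factors with `1 ≤ n ≤ N` (see `coeff_crankGF`). -/
noncomputable def crankGF (a : ℤ) : PowerSeries (LaurentPolynomial ℤ) :=
  PowerSeries.mk fun N => PowerSeries.coeff N (∏ n ∈ Finset.Icc 1 N, crankFactor a n)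

theorem crankFactor_mul (a : ℤ) {n : ℕ} (hn : 1 ≤ n) :
    crankFactor a n *
      ((1 - PowerSeries.C (LaurentPolynomial.T a) * PowerSeries.X ^ n) *
        (1 - PowerSeries.C (LaurentPolynomial.T (-a)) * PowerSeries.X ^ n)) =
      1 - PowerSeries.X ^ n := by
  have h0 : n ≠ 0 := by omega
  rw [crankFactor, mul_assoc, PowerSeries.invOfUnit_mul, mul_one]
  simp [h0]

theorem X_pow_dvd_crankFactor_sub_one (a : ℤ) {n : ℕ} (hn : 1 ≤ n) :
    (PowerSeries.X : PowerSeries (LaurentPolynomial ℤ)) ^ n ∣ crankFactor a n - 1 := by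
  have h0 : n ≠ 0 := by omega
  set D : PowerSeries (LaurentPolynomial ℤ) :=
    (1 - PowerSeries.C (LaurentPolynomial.T a) * PowerSeries.X ^ n) *
        (1 - PowerSeries.C (LaurentPolynomial.T (-a)) * PowerSeries.X ^ n) with hD
  have h1 : D * PowerSeries.invOfUnit D 1 = 1 := by
    apply PowerSeries.mul_invOfUnit
    simp [hD, h0]
  have h2 : crankFactor a n - 1 = ((1 - PowerSeries.X ^ n) - D) * PowerSeries.invOfUnit D 1 := by
    rw [sub_mul, h1]; rfl
  rw [h2]
  apply Dvd.dvd.mul_right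
  refine ⟨-1 + PowerSeries.C (LaurentPolynomial.T a) + PowerSeries.C (LaurentPolynomial.T (-a))
    - PowerSeries.C (LaurentPolynomial.T a) * PowerSeries.C (LaurentPolynomial.T (-a))
      * PowerSeries.X ^ n, ?_⟩
  rw [hD]; ring

theorem coeff_crankGF (a : ℤ) {N M : ℕ} (h : N ≤ M) :
    PowerSeries.coeff N (crankGF a) =
      PowerSeries.coeff N (∏ n ∈ Finset.Icc 1 M, crankFactor a n) := by
  induction M, h using Nat.le_induction with
  | base => simp [crankGF]
  | succ m hm ih =>
    obtain ⟨c, hc⟩ := X_pow_dvd_crankFactor_sub_one a (n := m + 1) (by omega)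
    rw [Finset.prod_Icc_succ_top (by omega), sub_eq_iff_eq_add.mp hc, mul_add, mul_one, map_add, ih,
      mul_left_comm, PowerSeries.coeff_X_pow_mul', if_neg (by omega), zero_add]

/-- The indicator `δ_odd(k)` of `k` being odd. -/
def deltaOdd (k : ℕ) : ℕ := if Odd k then 1 else 0

/-- The `k`-colored crank generating function with weights `a_1, a_2, …` (indexed from `0`),
`𝒞(0; τ) ^ ((k - δ_odd(k)) / 2) * ∏ i, 𝒞(a_i z; τ)`. -/
noncomputable def coloredCrankGF (k : ℕ) (a : Fin ((k + deltaOdd k) / 2) → ℤ) :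
    PowerSeries (LaurentPolynomial ℤ) :=
  crankGF 0 ^ ((k - deltaOdd k) / 2) * ∏ i, crankGF (a i)

/-- Some odd prime congruent to `2` modulo `3` divides `k + 14`. -/
def HasOddPrimeFactorTwoModThree (k : ℕ) : Prop :=
  ∃ p : ℕ, p.Prime ∧ Odd p ∧ p ≡ 2 [MOD 3] ∧ p ∣ k + 14

open Classical in
/-- The weights `k, k - 2, k - 4, …, 2 - δ_odd(k)`, except that the first weight `k` is replaced by
`k + 2` if an odd prime congruent to `2` modulo `3` divides `k + 14`. -/
noncomputable def crankWeight (k : ℕ) (i : Fin ((k + deltaOdd k) / 2)) : ℤ :=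
  if (i : ℕ) = 0 ∧ HasOddPrimeFactorTwoModThree k then (k : ℤ) + 2 else (k : ℤ) - 2 * (i : ℕ)

/-- The distinguished `k`-colored crank generating function `𝒞_k(z; τ)`. -/
noncomputable def kColoredCrankGF (k : ℕ) : PowerSeries (LaurentPolynomial ℤ) :=
  coloredCrankGF k (crankWeight k)

/-- The pair `(h, ℓ)` lies in one of the three families that afford a congruence modulo `ℓ` for
`k`-colored partitions with `ℓ ∣ k + h`. -/
def CongruenceFamily (h ℓ : ℕ) : Prop :=
  ((h = 4 ∨ h = 8 ∨ h = 14) ∧ ℓ ≡ 2 [MOD 3]) ∨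
    ((h = 6 ∨ h = 10) ∧ ℓ ≡ 3 [MOD 4]) ∨
      (h = 26 ∧ ℓ ≡ 11 [MOD 12])

/-- The condition on `k` and `ℓ` for the congruence progressions modulo `ℓ` for `k`-colored
partitions to be singular. -/
def IsSingularProgression (k ℓ : ℕ) : Prop :=
  (HasOddPrimeFactorTwoModThree k ∧ ℓ ≡ 2 [MOD 3] ∧ ℓ ∣ k + 8) ∨
    (ℓ ≡ 11 [MOD 12] ∧ ℓ ∣ k + 26)

/-!
Let `ζ` be a primitive `ℓ`-th root of unity. Since `Φ_ℓ` is its minimal polynomial, it suffices that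
the coefficients in question vanish at `ζ` (`cyclotomic_dvd_of_evalLaurent_eq_zero`).

The unmodified weights `±k, ±(k - 2), …`, together with the `h - 1` next terms of the arithmetic
progression `-k, -k + 2, …, k`, form `t` complete residue systems modulo `ℓ`, and the product of
`∏ (1 - ζ^r q^n)` over a complete residue system is a power series in `q^ℓ`. Hence, up to a power
series in `q^ℓ`, the crank generating function at `ζ` is a finite product over the missing residues
(`map_kColoredCrankGF_mul`), with `h - 2` replaced by `h` if the first weight is modified. This
product is a theta block, and we have to see that its `N`-th coefficient vanishes whenever
`ℓ ∣ 24 N + h` (`exists_vanishing_block`).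

In the variable `Q = q^(1/24)`, and up to constants and powers of `Q` and of `η`, the theta blocks
are `η θ(x)`, `θ(x) θ(y)` and the denominators of the affine root systems of types `A₂`, `B₂` and
`G₂`, for `h = 4, 6, 8, 10, 14`. By the denominator identities (`theta_mul_A₂`, `theta_mul_B₂`,
`theta_mul_G₂`), each of them is a power of `η` times a series `∑ w(v) x^(v₁) y^(v₂) Q^(f(v))` over
`v ∈ ℤ²`, where `f` is, up to a translation and a constant factor, the norm form of `ℚ(√-3)` or of
`ℚ(i)`. As `ℓ` is inert in this field, `ℓ ∣ f(v)` determines `v` modulo `ℓ`. So the monomial `x^(v₁) y^(v₂)`, in `ℓ`-th roots of unity, is the same for all terms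
that contribute to a coefficient with `ℓ ∣ 24 N + h`, and this coefficient is a monomial times the
one for `x = y = 1`. The latter is zero, because `θ(1) = 0`.

The denominator identities are deduced from the Jacobi triple product and the pentagonal number
theorem, by multiplying out series and summing along lines of the lattice of all summation indices:
on each line the exponent is a square plus a constant, so that a factor `η` splits off
(`latticeSeries_fibration`). For `G₂`, the six theta functions are first grouped into three pairs
by the addition formula `theta_mul_theta`. The product of the three `2 × 2` determinants that arise
is a Vandermonde determinant in the squares and products of the even and odd parts of theta
functions, which are again theta functions.

For `h = 26` the progression is always singular. For `h = 8` it is singular if the first weight is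
modified, and for `h = 14` the first weight is always modified, `ℓ` itself being a prime factor of
`k + 14`. The pair `(h, ℓ) = (14, 5)`, for which the block of type `G₂` degenerates, is covered by
the pair `(4, 5)`.
-/

/-! ### Series indexed by lattices -/

/-- The power series `∑ i, c i * X ^ (e i)`. Its coefficients are `finsum`s, so it is meaningful
for admissible data (see `Admissible`). -/
noncomputable def latticeSeries {ι R : Type*} [CommRing R] (c : ι → R) (e : ι → ℤ) :
    PowerSeries R :=
  PowerSeries.mk fun N => ∑ᶠ i, if e i = (N : ℤ) then c i else 0

/-- On the support of `c` the exponents `e` are nonnegative, and each of them is attained only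
finitely often. -/
structure Admissible {ι R : Type*} [CommRing R] (c : ι → R) (e : ι → ℤ) : Prop where
  nonneg : ∀ i, c i ≠ 0 → 0 ≤ e i
  finite : ∀ N : ℤ, {i | c i ≠ 0 ∧ e i ≤ N}.Finite

namespace Admissible

variable {ι κ R : Type*} [CommRing R] {c : ι → R} {e : ι → ℤ} {c' : κ → R} {e' : κ → ℤ}

theorem coeff_eq_sum (h : Admissible c e) {N : ℕ} {M : ℤ} (hM : (N : ℤ) ≤ M) :
    PowerSeries.coeff N (latticeSeries c e) =
      ∑ i ∈ (h.finite M).toFinset, if e i = (N : ℤ) then c i else 0 := by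
  rw [latticeSeries, PowerSeries.coeff_mk]
  apply finsum_eq_sum_of_support_subset
  intro i hi
  simp only [Function.mem_support, ne_eq, ite_eq_right_iff, not_forall] at hi
  obtain ⟨h1, h2⟩ := hi
  simp only [Set.Finite.coe_toFinset, Set.mem_ofPred_eq]
  exact ⟨h2, by omega⟩

theorem comp (h : Admissible c' e') (f : ι → κ) (hf : Function.Injective f) :
    Admissible (fun i => c' (f i)) (fun i => e' (f i)) :=
  ⟨fun i => h.nonneg (f i), fun N => (h.finite N).preimage hf.injOn⟩

theorem of_support {c₁ : ι → R} (h : Admissible c e) (hc : ∀ i, c₁ i ≠ 0 → c i ≠ 0) :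
    Admissible c₁ e :=
  ⟨fun i hi => h.nonneg i (hc i hi), fun N => (h.finite N).subset fun _ hi => ⟨hc _ hi.1, hi.2⟩⟩

theorem mul (h : Admissible c e) (h' : Admissible c' e') :
    Admissible (fun p : ι × κ => c p.1 * c' p.2) (fun p => e p.1 + e' p.2) := by
  refine ⟨fun p hp => add_nonneg (h.nonneg _ (left_ne_zero_of_mul hp))
    (h'.nonneg _ (right_ne_zero_of_mul hp)), fun N => ?_⟩
  refine ((h.finite N).prod (h'.finite N)).subset ?_
  rintro ⟨i, j⟩ ⟨hc, hN⟩
  have h1 := left_ne_zero_of_mul hc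
  have h2 := right_ne_zero_of_mul hc
  have h3 := h.nonneg _ h1
  have h4 := h'.nonneg _ h2
  simp only at hN h1 h2 h3 h4
  exact ⟨⟨h1, by dsimp only; linarith⟩, ⟨h2, by dsimp only; linarith⟩⟩

/-- Data are admissible as soon as the exponents dominate the absolute values of an injective
map to `ℤ`. -/
theorem of_abs_le (f : ι → ℤ) (hf : Function.Injective f) (he : ∀ i, |f i| ≤ e i) :
    Admissible c e := by
  refine ⟨fun i _ => (abs_nonneg _).trans (he i), fun N => ?_⟩
  refine ((Set.finite_Icc (-N) N).preimage hf.injOn).subset ?_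
  rintro i ⟨-, hi⟩
  exact abs_le.mp ((he i).trans hi)

end Admissible

section

variable {ι κ R : Type*} [CommRing R] {c : ι → R} {e : ι → ℤ} {c' : κ → R} {e' : κ → ℤ}

theorem latticeSeries_mul (h : Admissible c e) (h' : Admissible c' e') :
    latticeSeries c e * latticeSeries c' e' =
      latticeSeries (fun p : ι × κ => c p.1 * c' p.2) (fun p => e p.1 + e' p.2) := by
  ext N
  have hR : PowerSeries.coeff N
      (latticeSeries (fun p : ι × κ => c p.1 * c' p.2) (fun p => e p.1 + e' p.2)) =
      ∑ p ∈ (h.finite N).toFinset ×ˢ (h'.finite N).toFinset,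
        if e p.1 + e' p.2 = (N : ℤ) then c p.1 * c' p.2 else 0 := by
    rw [latticeSeries, PowerSeries.coeff_mk]
    apply finsum_eq_sum_of_support_subset
    rintro ⟨i, j⟩ hi
    simp only [Function.mem_support, ne_eq, ite_eq_right_iff, not_forall] at hi
    obtain ⟨h1, h2⟩ := hi
    have h5 := left_ne_zero_of_mul h2
    have h6 := right_ne_zero_of_mul h2
    have h3 := h.nonneg _ h5
    have h4 := h'.nonneg _ h6
    simp only [Finset.coe_product, Set.Finite.coe_toFinset, Set.mem_prod, Set.mem_ofPred_eq]
    exact ⟨⟨h5, by omega⟩, ⟨h6, by omega⟩⟩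
  rw [hR, PowerSeries.coeff_mul]
  have hL : ∀ p ∈ Finset.HasAntidiagonal.antidiagonal N, PowerSeries.coeff p.1 (latticeSeries c e) *
      PowerSeries.coeff p.2 (latticeSeries c' e') =
      ∑ x ∈ (h.finite N).toFinset ×ˢ (h'.finite N).toFinset,
        if e x.1 = (p.1 : ℤ) ∧ e' x.2 = (p.2 : ℤ) then c x.1 * c' x.2 else 0 := by
    intro p hp
    have hp' := Finset.HasAntidiagonal.mem_antidiagonal.mp hp
    rw [h.coeff_eq_sum (M := N) (by omega), h'.coeff_eq_sum (M := N) (by omega),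
      Finset.sum_mul_sum, ← Finset.sum_product']
    refine Finset.sum_congr rfl fun x _ => ?_
    split_ifs <;> simp_all
  rw [Finset.sum_congr rfl hL, Finset.sum_comm]
  refine Finset.sum_congr rfl fun x hx => ?_
  simp only [Finset.mem_product, Set.Finite.mem_toFinset, Set.mem_ofPred_eq] at hx
  have h1 := h.nonneg _ hx.1.1
  have h2 := h'.nonneg _ hx.2.1
  split_ifs with hN
  · rw [Finset.sum_eq_single ((e x.1).toNat, (e' x.2).toNat)]
    · rw [if_pos ⟨by simp [h1], by simp [h2]⟩]
    · rintro ⟨a, b⟩ _ hab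
      rw [if_neg]
      rintro ⟨ha, hb⟩
      apply hab
      simp only at ha hb
      ext <;> simp <;> omega
    · intro hn
      exfalso
      apply hn
      rw [Finset.HasAntidiagonal.mem_antidiagonal]
      dsimp only
      omega
  · apply Finset.sum_eq_zero
    rintro ⟨a, b⟩ hab
    rw [Finset.HasAntidiagonal.mem_antidiagonal] at hab
    rw [if_neg]
    rintro ⟨ha, hb⟩
    simp only at ha hb hab
    omega

theorem latticeSeries_add {c₁ c₂ : ι → R} (h₁ : Admissible c₁ e) (h₂ : Admissible c₂ e) :
    latticeSeries c₁ e + latticeSeries c₂ e = latticeSeries (fun i => c₁ i + c₂ i) e := by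
  ext N
  rw [map_add]
  simp only [latticeSeries, PowerSeries.coeff_mk]
  rw [← finsum_add_distrib]
  · refine finsum_congr fun i => ?_
    split_ifs <;> simp
  · refine (h₁.finite N).subset fun i hi => ?_
    simp only [Function.mem_support, ne_eq, ite_eq_right_iff, not_forall] at hi
    exact ⟨hi.2, hi.1.le⟩
  · refine (h₂.finite N).subset fun i hi => ?_
    simp only [Function.mem_support, ne_eq, ite_eq_right_iff, not_forall] at hi
    exact ⟨hi.2, hi.1.le⟩

theorem latticeSeries_congr {c₁ : ι → R} {e₁ : ι → ℤ} (hc : ∀ i, c i = c₁ i)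
    (he : ∀ i, c i ≠ 0 → e i = e₁ i) : latticeSeries c e = latticeSeries c₁ e₁ := by
  ext N
  simp only [latticeSeries, PowerSeries.coeff_mk]
  refine finsum_congr fun i => ?_
  by_cases h : c i = 0
  · simp [h, ← hc i]
  · rw [he i h, hc i]

theorem C_mul_latticeSeries (h : Admissible c e) (a : R) :
    PowerSeries.C a * latticeSeries c e = latticeSeries (fun i => a * c i) e := by
  ext N
  rw [PowerSeries.coeff_C_mul]
  simp only [latticeSeries, PowerSeries.coeff_mk]
  rw [mul_finsum']
  · refine finsum_congr fun i => ?_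
    split_ifs <;> simp
  · refine (h.finite N).subset fun i hi => ?_
    simp only [Function.mem_support, ne_eq, ite_eq_right_iff, not_forall] at hi
    exact ⟨hi.2, hi.1.le⟩

theorem latticeSeries_neg : -latticeSeries c e = latticeSeries (fun i => -c i) e := by
  ext N
  rw [map_neg]
  simp only [latticeSeries, PowerSeries.coeff_mk]
  rw [← finsum_neg_distrib]
  refine finsum_congr fun i => ?_
  split_ifs <;> simp

/-- Reindexing along an injective map whose range contains the support. -/
theorem latticeSeries_comp (f : ι → κ) (hf : Function.Injective f)
    (hc : ∀ j, c' j ≠ 0 → j ∈ Set.range f) :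
    latticeSeries (fun i => c' (f i)) (fun i => e' (f i)) = latticeSeries c' e' := by
  ext N
  simp only [latticeSeries, PowerSeries.coeff_mk]
  symm
  rw [← finsum_mem_univ (f := fun j => if e' j = (N : ℤ) then c' j else 0),
    ← finsum_mem_inter_support, Set.univ_inter]
  rw [← finsum_mem_range (f := fun j => if e' j = (N : ℤ) then c' j else 0) hf,
    ← finsum_mem_inter_support _ (Set.range f)]
  rw [Set.inter_eq_right.mpr]
  intro j hj
  simp only [Function.mem_support, ne_eq, ite_eq_right_iff, not_forall] at hj
  exact hc j hj.2

/-- A series whose coefficients change sign under an exponent-preserving permutation vanishes. -/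
theorem latticeSeries_eq_zero_of_antisymm [NoZeroDivisors R] [CharZero R] (σ : ι ≃ ι)
    (hc : ∀ i, c (σ i) = -c i) (he : ∀ i, c i ≠ 0 → e (σ i) = e i) : latticeSeries c e = 0 := by
  have h : latticeSeries c e = -latticeSeries c e := by
    conv_lhs => rw [← latticeSeries_comp (c' := c) (e' := e) σ σ.injective
      (fun j _ => σ.surjective j)]
    rw [latticeSeries_neg]
    refine latticeSeries_congr hc fun i hi => he i ?_
    rw [hc i] at hi
    exact neg_ne_zero.mp hi
  ext N
  have h2 := congrArg (PowerSeries.coeff N) h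
  rw [map_neg, self_eq_neg] at h2
  simpa using h2

theorem expand_latticeSeries (p : ℕ) (hp : p ≠ 0) :
    PowerSeries.expand p hp (latticeSeries c e) = latticeSeries c (fun i => p * e i) := by
  ext N
  have hp' : (p : ℤ) ≠ 0 := by exact_mod_cast hp
  rw [PowerSeries.coeff_expand]
  split_ifs with h
  · obtain ⟨M, rfl⟩ := h
    rw [Nat.mul_div_cancel_left _ (Nat.pos_of_ne_zero hp)]
    simp only [latticeSeries, PowerSeries.coeff_mk]
    refine finsum_congr fun i => ?_
    congr 1
    push_cast
    exact propext (mul_right_inj' hp').symm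
  · simp only [latticeSeries, PowerSeries.coeff_mk]
    symm
    apply finsum_eq_zero_of_forall_eq_zero
    intro i
    rw [if_neg]
    intro h2
    apply h
    exact Int.natCast_dvd_natCast.mp ⟨_, h2.symm⟩

end

/-! ### Infinite products -/

section

variable {R : Type*} [CommRing R]

/-- The coefficients of `f M` of index at most `M` are those of `P`: the sequence `f` of partial
products converges to `P`, with this rate. -/
def HasTruncations (f : ℕ → PowerSeries R) (P : PowerSeries R) : Prop :=
  ∀ N M : ℕ, N ≤ M → PowerSeries.coeff N P = PowerSeries.coeff N (f M)

namespace HasTruncations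

variable {f g : ℕ → PowerSeries R} {P Q : PowerSeries R}

theorem unique (hP : HasTruncations f P) (hQ : HasTruncations f Q) : P = Q := by
  ext N
  rw [hP N N le_rfl, hQ N N le_rfl]

theorem mul (hP : HasTruncations f P) (hQ : HasTruncations g Q) :
    HasTruncations (fun M => f M * g M) (P * Q) := by
  intro N M h
  rw [PowerSeries.coeff_mul, PowerSeries.coeff_mul]
  refine Finset.sum_congr rfl fun p hp => ?_
  have := Finset.HasAntidiagonal.mem_antidiagonal.mp hp
  rw [hP p.1 M (by omega), hQ p.2 M (by omega)]

theorem prod {ι : Type*} (s : Finset ι) {f : ι → ℕ → PowerSeries R} {P : ι → PowerSeries R}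
    (h : ∀ i ∈ s, HasTruncations (f i) (P i)) :
    HasTruncations (fun M => ∏ i ∈ s, f i M) (∏ i ∈ s, P i) := by
  classical
  induction s using Finset.induction_on with
  | empty => intro N M _; simp
  | insert a s ha ih =>
    simp only [Finset.prod_insert ha]
    exact (h a (Finset.mem_insert_self a s)).mul
      (ih fun i hi => h i (Finset.mem_insert_of_mem hi))

theorem expand (hP : HasTruncations f P) (p : ℕ) (hp : p ≠ 0) :
    HasTruncations (fun M => PowerSeries.expand p hp (f M)) (PowerSeries.expand p hp P) := by
  intro N M h
  rw [PowerSeries.coeff_expand, PowerSeries.coeff_expand]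
  split_ifs
  · exact hP _ _ ((Nat.div_le_self N p).trans h)
  · rfl

theorem map {S : Type*} [CommRing S] (φ : R →+* S) (hP : HasTruncations f P) :
    HasTruncations (fun M => PowerSeries.map φ (f M)) (PowerSeries.map φ P) := by
  intro N M h
  rw [PowerSeries.coeff_map, PowerSeries.coeff_map, hP N M h]

end HasTruncations

/-- The infinite product `∏_{n ≥ 1} (1 - x q^n)`. -/
noncomputable def qProd (x : R) : PowerSeries R :=
  PowerSeries.mk fun N => PowerSeries.coeff N
    (∏ n ∈ Finset.Icc 1 N, (1 - PowerSeries.C x * PowerSeries.X ^ n))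

theorem hasTruncations_qProd (x : R) :
    HasTruncations (fun M => ∏ n ∈ Finset.Icc 1 M, (1 - PowerSeries.C x * PowerSeries.X ^ n))
      (qProd x) := by
  intro N M h
  induction M, h using Nat.le_induction with
  | base => simp [qProd]
  | succ m hm ih =>
    dsimp only at ih ⊢
    rw [ih, Finset.prod_Icc_succ_top (by omega), mul_sub, mul_one, map_sub, mul_left_comm,
      PowerSeries.coeff_C_mul, PowerSeries.coeff_mul_X_pow', if_neg (by omega)]
    simp

/-- A factorisation `∏ (1 - x_i y) = 1 - z y^r` carries over to the infinite products. -/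
theorem prod_qProd_eq_expand {ι : Type*} (s : Finset ι) (x : ι → R) (z : R) (r : ℕ) (hr : r ≠ 0)
    (h : ∀ y : PowerSeries R,
      ∏ i ∈ s, (1 - PowerSeries.C (x i) * y) = 1 - PowerSeries.C z * y ^ r) :
    ∏ i ∈ s, qProd (x i) = PowerSeries.expand r hr (qProd z) := by
  refine (HasTruncations.prod s fun i _ => hasTruncations_qProd (x i)).unique ?_
  convert (hasTruncations_qProd z).expand r hr using 2 with M
  rw [Finset.prod_comm, map_prod]
  refine Finset.prod_congr rfl fun n _ => ?_
  rw [h, map_sub, map_one, map_mul, map_pow, PowerSeries.expand_X, PowerSeries.expand_C,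
    ← pow_mul, ← pow_mul, mul_comm n r]

theorem constantCoeff_qProd (x : R) : PowerSeries.constantCoeff (qProd x) = 1 := by
  rw [← PowerSeries.coeff_zero_eq_constantCoeff_apply, hasTruncations_qProd x 0 0 le_rfl]
  simp

theorem qProd_ne_zero [Nontrivial R] (x : R) : qProd x ≠ 0 := by
  intro h
  have := constantCoeff_qProd x
  rw [h, map_zero] at this
  exact zero_ne_one this

end

/-! ### The Jacobi triple product -/

/-- The exponent `k (k - 1) / 2`. -/
def triangle (k : ℤ) : ℕ := (k * (k - 1) / 2).toNat

theorem two_mul_triangle (k : ℤ) : 2 * (triangle k : ℤ) = k * (k - 1) := by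
  have h1 : (2 : ℤ) ∣ k * (k - 1) := by
    rcases Int.even_or_odd k with h | h
    · exact Dvd.dvd.mul_right h.two_dvd _
    · exact Dvd.dvd.mul_left (by obtain ⟨m, rfl⟩ := h; exact ⟨m, by ring⟩) _
  have h2 : 0 ≤ k * (k - 1) := by
    rcases le_or_gt k 0 with h | h
    · exact mul_nonneg_of_nonpos_of_nonpos h (by omega)
    · exact mul_nonneg h.le (by omega)
  rw [triangle, Int.toNat_of_nonneg (Int.ediv_nonneg h2 (by norm_num)), Int.mul_ediv_cancel' h1]

section

open PowerSeries

variable {K : Type*} [Field K]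

/-- The finite product `(1 - q) (1 - q^2) ⋯ (1 - q^m)`. -/
noncomputable def qFactorial (K : Type*) [Field K] (m : ℕ) : PowerSeries K :=
  ∏ n ∈ Finset.Icc 1 m, (1 - X ^ n)

theorem qFactorial_succ (m : ℕ) :
    qFactorial K (m + 1) = qFactorial K m * (1 - X ^ (m + 1)) :=
  Finset.prod_Icc_succ_top (by omega) _

theorem isUnit_qFactorial (m : ℕ) : IsUnit (qFactorial K m) := by
  rw [PowerSeries.isUnit_iff_constantCoeff, qFactorial, map_prod]
  rw [Finset.prod_eq_one]
  · exact isUnit_one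
  · intro n hn
    have : n ≠ 0 := by have := (Finset.mem_Icc.mp hn).1; omega
    simp [this]

theorem hasTruncations_qFactorial : HasTruncations (qFactorial K) (qProd (1 : K)) := by
  convert hasTruncations_qProd (1 : K) using 2 with M
  simp [qFactorial]

theorem X_pow_dvd_qProd_one_sub_qFactorial {m n : ℕ} (h : n ≤ m + 1) :
    (X : PowerSeries K) ^ n ∣ qProd 1 - qFactorial K m := by
  rw [PowerSeries.X_pow_dvd_iff]
  intro i hi
  rw [map_sub, hasTruncations_qFactorial i m (by omega), sub_self]

/-- The terms of the expansion of `∏_{n < N} (1 - x q^n) (1 - x⁻¹ q^(n+1))` according to the power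
`x ^ k`, defined by the recursion that multiplication by the next two factors gives. -/
noncomputable def tripleProductTerm (x : K) : ℕ → ℤ → PowerSeries K
  | 0, k => if k = 0 then 1 else 0
  | N + 1, k => (1 + X ^ (2 * N + 1)) * tripleProductTerm x N k
      - C x * X ^ N * tripleProductTerm x N (k - 1)
      - C x⁻¹ * X ^ (N + 1) * tripleProductTerm x N (k + 1)

theorem tripleProductTerm_eq_zero (x : K) (N : ℕ) (k : ℤ) (h : (N : ℤ) < |k|) :
    tripleProductTerm x N k = 0 := by
  induction N generalizing k with
  | zero =>
    rw [tripleProductTerm, if_neg]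
    rintro rfl
    simp at h
  | succ N ih =>
    push_cast at h
    rw [tripleProductTerm, ih k (by omega), ih (k - 1) (lt_abs.mpr (by have := lt_abs.mp h; omega)),
      ih (k + 1) (lt_abs.mpr (by have := lt_abs.mp h; omega))]
    simp

theorem support_tripleProductTerm (x : K) (N : ℕ) :
    Function.support (tripleProductTerm x N) ⊆ (Finset.Icc (-N : ℤ) N : Finset ℤ) := by
  intro k hk
  rw [Finset.coe_Icc]
  by_contra h
  apply hk
  apply tripleProductTerm_eq_zero
  rw [Set.mem_Icc, ← abs_le] at h
  omega

theorem finsum_tripleProductTerm {x : K} (hx : x ≠ 0) (N : ℕ) :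
    ∑ᶠ k, tripleProductTerm x N k =
      ∏ n ∈ Finset.range N, ((1 - C x * X ^ n) * (1 - C x⁻¹ * X ^ (n + 1))) := by
  induction N with
  | zero =>
    rw [finsum_eq_single _ 0]
    · simp [tripleProductTerm]
    · intro k hk
      simp [tripleProductTerm, hk]
  | succ N ih =>
    have hf : (Function.support (tripleProductTerm x N)).Finite :=
      (Finset.finite_toSet _).subset (support_tripleProductTerm x N)
    have h1 : (Function.support fun k => tripleProductTerm x N (k - 1)).Finite :=
      hf.preimage (sub_left_injective.injOn)
    have h2 : (Function.support fun k => tripleProductTerm x N (k + 1)).Finite :=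
      hf.preimage (add_left_injective 1).injOn
    have e1 : ∑ᶠ k, tripleProductTerm x N (k - 1) = ∑ᶠ k, tripleProductTerm x N k :=
      finsum_comp_equiv (Equiv.subRight (1 : ℤ)) (f := tripleProductTerm x N)
    have e2 : ∑ᶠ k, tripleProductTerm x N (k + 1) = ∑ᶠ k, tripleProductTerm x N k :=
      finsum_comp_equiv (Equiv.addRight (1 : ℤ)) (f := tripleProductTerm x N)
    have hsub : ∀ (a : PowerSeries K) (g : ℤ → PowerSeries K), (Function.support g).Finite →
        (Function.support fun k => a * g k).Finite := fun a g hg =>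
      hg.subset fun k hk => right_ne_zero_of_mul hk
    rw [Finset.prod_range_succ, ← ih, finsum_congr fun k => by rw [tripleProductTerm],
      finsum_sub_distrib, finsum_sub_distrib, ← mul_finsum', ← mul_finsum', ← mul_finsum', e1, e2]
    · have : C x * C x⁻¹ = (1 : PowerSeries K) := by
        rw [← map_mul, mul_inv_cancel₀ hx, map_one]
      linear_combination (-X ^ (2 * N + 1) * ∑ᶠ k, tripleProductTerm x N k) * this
    · exact h2
    · exact h1
    · exact hf
    · exact hsub _ _ hf
    · exact hsub _ _ h1
    · exact ((hsub _ _ hf).union (hsub _ _ h1)).subset (Function.support_sub _ _)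
    · exact hsub _ _ h2

/-- The terms of the finite product are Gaussian binomial coefficients, up to a monomial. -/
theorem tripleProductTerm_mul {x : K} (hx : x ≠ 0) (N i j : ℕ) (k : ℤ) (hi : (i : ℤ) = N - k)
    (hj : (j : ℤ) = N + k) :
    tripleProductTerm x N k * qFactorial K i * qFactorial K j =
      C ((-x) ^ k) * X ^ triangle k * qFactorial K (2 * N) := by
  induction N generalizing i j k with
  | zero =>
    obtain rfl : k = 0 := by omega
    obtain rfl : i = 0 := by omega
    obtain rfl : j = 0 := by omega
    simp [tripleProductTerm, qFactorial, triangle]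
  | succ N ih =>
    have hx' : -x ≠ 0 := neg_ne_zero.mpr hx
    have hC1 : C x * C ((-x) ^ (k - 1)) = -C ((-x) ^ k) := by
      rw [← map_mul, ← map_neg, zpow_sub_one₀ hx']
      congr 1
      field_simp
    have hC2 : C x⁻¹ * C ((-x) ^ (k + 1)) = -C ((-x) ^ k) := by
      rw [← map_mul, ← map_neg, zpow_add_one₀ hx']
      congr 1
      field_simp
    have t0 := two_mul_triangle k
    have t1 := two_mul_triangle (k - 1)
    have t2 := two_mul_triangle (k + 1)
    have h2N : qFactorial K (2 * (N + 1)) =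
        qFactorial K (2 * N) * (1 - X ^ (2 * N + 1)) * (1 - X ^ (2 * N + 2)) := by
      rw [show 2 * (N + 1) = 2 * N + 1 + 1 by ring, qFactorial_succ, qFactorial_succ]
    have A : tripleProductTerm x N k * qFactorial K i * qFactorial K j =
        C ((-x) ^ k) * X ^ triangle k * qFactorial K (2 * N) * (1 - X ^ i) * (1 - X ^ j) := by
      rcases i with _ | i
      · rw [tripleProductTerm_eq_zero x N k (lt_abs.mpr (by push_cast at *; omega))]
        simp
      rcases j with _ | j
      · rw [tripleProductTerm_eq_zero x N k (lt_abs.mpr (by push_cast at *; omega))]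
        simp
      rw [qFactorial_succ, qFactorial_succ]
      have := ih i j k (by push_cast at *; omega) (by push_cast at *; omega)
      linear_combination (1 - X ^ (i + 1)) * (1 - X ^ (j + 1)) * this
    have B : C x * X ^ N * tripleProductTerm x N (k - 1) * qFactorial K i * qFactorial K j =
        -(C ((-x) ^ k) * X ^ triangle k * qFactorial K (2 * N)) * X ^ i * (1 - X ^ j) *
          (1 - X ^ (j - 1)) := by
      rcases j with _ | _ | j
      · rw [tripleProductTerm_eq_zero x N (k - 1) (lt_abs.mpr (by push_cast at *; omega))]
        simp
      · rw [tripleProductTerm_eq_zero x N (k - 1) (lt_abs.mpr (by push_cast at *; omega))]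
        simp
      rw [qFactorial_succ, qFactorial_succ]
      have := ih i j (k - 1) (by push_cast at *; omega) (by push_cast at *; omega)
      have hX : (X : PowerSeries K) ^ N * X ^ triangle (k - 1) = X ^ triangle k * X ^ i := by
        rw [← pow_add, ← pow_add]
        congr 1
        push_cast at *
        have : (2 : ℤ) * (N + triangle (k - 1)) = 2 * (triangle k + i) := by
          linear_combination t1 - t0 - 2 * hi
        omega
      rw [show j + 1 + 1 - 1 = j + 1 by omega]
      linear_combination (C x * X ^ N * (1 - X ^ (j + 1)) * (1 - X ^ (j + 1 + 1))) * this +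
        (X ^ N * X ^ triangle (k - 1) * qFactorial K (2 * N) * (1 - X ^ (j + 1)) *
          (1 - X ^ (j + 1 + 1))) * hC1 - (C ((-x) ^ k) * qFactorial K (2 * N) *
          (1 - X ^ (j + 1)) * (1 - X ^ (j + 1 + 1))) * hX
    have D : C x⁻¹ * X ^ (N + 1) * tripleProductTerm x N (k + 1) * qFactorial K i *
        qFactorial K j =
        -(C ((-x) ^ k) * X ^ triangle k * qFactorial K (2 * N)) * X ^ j * (1 - X ^ i) *
          (1 - X ^ (i - 1)) := by
      rcases i with _ | _ | i
      · rw [tripleProductTerm_eq_zero x N (k + 1) (lt_abs.mpr (by push_cast at *; omega))]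
        simp
      · rw [tripleProductTerm_eq_zero x N (k + 1) (lt_abs.mpr (by push_cast at *; omega))]
        simp
      rw [qFactorial_succ, qFactorial_succ]
      have := ih i j (k + 1) (by push_cast at *; omega) (by push_cast at *; omega)
      have hX : (X : PowerSeries K) ^ (N + 1) * X ^ triangle (k + 1) =
          X ^ triangle k * X ^ j := by
        rw [← pow_add, ← pow_add]
        congr 1
        push_cast at *
        have : (2 : ℤ) * (N + 1 + triangle (k + 1)) = 2 * (triangle k + j) := by
          linear_combination t2 - t0 - 2 * hj
        omega
      rw [show i + 1 + 1 - 1 = i + 1 by omega]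
      linear_combination (C x⁻¹ * X ^ (N + 1) * (1 - X ^ (i + 1)) * (1 - X ^ (i + 1 + 1))) * this +
        (X ^ (N + 1) * X ^ triangle (k + 1) * qFactorial K (2 * N) * (1 - X ^ (i + 1)) *
          (1 - X ^ (i + 1 + 1))) * hC2 - (C ((-x) ^ k) * qFactorial K (2 * N) *
          (1 - X ^ (i + 1)) * (1 - X ^ (i + 1 + 1))) * hX
    have hij : i + j = 2 * N + 2 := by push_cast at *; omega
    rw [tripleProductTerm, h2N]
    -- the combination of the two Pascal rules for Gaussian binomials that the recursion amounts to
    have key : (1 + X ^ (2 * N + 1)) * ((1 - X ^ i) * (1 - X ^ j)) +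
        X ^ i * (1 - X ^ j) * (1 - X ^ (j - 1)) + X ^ j * (1 - X ^ i) * (1 - X ^ (i - 1)) =
        (1 - X ^ (2 * N + 1)) * (1 - (X : PowerSeries K) ^ (2 * N + 2)) := by
      rcases i with _ | i
      · have : j = 2 * N + 1 + 1 := by omega
        subst this
        simp
        ring
      rcases j with _ | j
      · have : i = 2 * N + 1 := by omega
        subst this
        simp
        ring
      have : 2 * N = i + j := by omega
      simp only [this, Nat.add_sub_cancel]
      ring
    linear_combination (1 + X ^ (2 * N + 1)) * A - B - D +
      (C ((-x) ^ k) * X ^ triangle k * qFactorial K (2 * N)) * key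

theorem coeff_qProd_one_mul_tripleProductTerm {x : K} (hx : x ≠ 0) {M N : ℕ} (hN : 2 * M + 2 ≤ N)
    {k : ℤ} (hk : |k| ≤ N) :
    coeff M (qProd 1 * tripleProductTerm x N k) =
      if (triangle k : ℤ) = M then (-x) ^ k else 0 := by
  have hk' := abs_le.mp hk
  obtain ⟨i, hi⟩ := Int.eq_ofNat_of_zero_le (a := N - k) (by omega)
  obtain ⟨j, hj⟩ := Int.eq_ofNat_of_zero_le (a := N + k) (by omega)
  have h := tripleProductTerm_mul hx N i j k hi.symm hj.symm
  have hu : IsUnit (qFactorial K i * qFactorial K j) :=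
    (isUnit_qFactorial i).mul (isUnit_qFactorial j)
  have hT : (X : PowerSeries K) ^ triangle k ∣ tripleProductTerm x N k := by
    rw [← hu.dvd_mul_right, ← mul_assoc, h]
    exact Dvd.dvd.mul_right (Dvd.dvd.mul_left dvd_rfl _) _
  by_cases hM : M < triangle k
  · rw [if_neg (by omega)]
    exact PowerSeries.X_pow_dvd_iff.mp (hT.mul_left _) M hM
  have t0 := two_mul_triangle k
  have hkM : |k| ≤ M + 1 := by
    push Not at hM
    zify at hM
    rw [abs_le]
    constructor <;> nlinarith
  have hiM : M + 1 ≤ i := by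
    have := (abs_le.mp hkM).2
    omega
  have hjM : M + 1 ≤ j := by
    have := (abs_le.mp hkM).1
    omega
  have hd : (X : PowerSeries K) ^ (M + 1) ∣ qProd 1 * tripleProductTerm x N k -
      C ((-x) ^ k) * X ^ triangle k := by
    rw [← hu.dvd_mul_right]
    have e : (qProd 1 * tripleProductTerm x N k - C ((-x) ^ k) * X ^ triangle k) *
        (qFactorial K i * qFactorial K j) = C ((-x) ^ k) * X ^ triangle k *
        (qProd 1 * (qFactorial K (2 * N) - qProd 1) + (qProd 1 - qFactorial K i) * qProd 1 +
          qFactorial K i * (qProd 1 - qFactorial K j)) := by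
      linear_combination qProd 1 * h
    rw [e]
    refine Dvd.dvd.mul_left (dvd_add (dvd_add ?_ ?_) ?_) _
    · refine Dvd.dvd.mul_left ?_ _
      rw [← dvd_neg, neg_sub]
      exact X_pow_dvd_qProd_one_sub_qFactorial (by omega)
    · exact Dvd.dvd.mul_right (X_pow_dvd_qProd_one_sub_qFactorial (by omega)) _
    · exact Dvd.dvd.mul_left (X_pow_dvd_qProd_one_sub_qFactorial (by omega)) _
  have := PowerSeries.X_pow_dvd_iff.mp hd M (by omega)
  rw [map_sub, sub_eq_zero, PowerSeries.coeff_C_mul, PowerSeries.coeff_X_pow] at this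
  rw [this]
  simp only [Nat.cast_inj, eq_comm (a := M)]
  split_ifs <;> simp

/-- The Jacobi triple product identity. -/
theorem jacobi_triple_product {x : K} (hx : x ≠ 0) :
    C (1 - x) * (qProd 1 * qProd x * qProd x⁻¹) =
      latticeSeries (fun k : ℤ => (-x) ^ k) (fun k => triangle k) := by
  have hprod : HasTruncations (fun M => qProd 1 * ∑ᶠ k, tripleProductTerm x (2 * M + 2) k)
      (C (1 - x) * (qProd 1 * qProd x * qProd x⁻¹)) := by
    intro N M hNM
    have h1 : C (1 - x) * (∏ n ∈ Finset.Icc 1 (2 * M + 2), (1 - C x * X ^ n)) *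
        (∏ n ∈ Finset.Icc 1 (2 * M + 2), (1 - C x⁻¹ * X ^ n)) =
        (1 - C x * X ^ (2 * M + 2)) * ∑ᶠ k, tripleProductTerm x (2 * M + 2) k := by
      rw [finsum_tripleProductTerm hx]
      generalize 2 * M + 2 = m
      induction m with
      | zero => simp
      | succ m ih =>
        rw [Finset.prod_Icc_succ_top (by omega), Finset.prod_Icc_succ_top (by omega),
          Finset.prod_range_succ]
        linear_combination (1 - C x * X ^ (m + 1)) * (1 - C x⁻¹ * X ^ (m + 1)) * ih
    have h2 : coeff N (C (1 - x) * (qProd 1 * qProd x * qProd x⁻¹)) =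
        coeff N (qProd 1 * (C (1 - x) * (∏ n ∈ Finset.Icc 1 (2 * M + 2), (1 - C x * X ^ n)) *
        (∏ n ∈ Finset.Icc 1 (2 * M + 2), (1 - C x⁻¹ * X ^ n)))) := by
      have t : ∀ P : PowerSeries K, HasTruncations (fun _ => P) P := fun P _ _ _ => rfl
      have := ((t (C (1 - x))).mul (((t (qProd 1)).mul (hasTruncations_qProd x)).mul
        (hasTruncations_qProd x⁻¹))) N (2 * M + 2) (by omega)
      rw [this]
      congr 1
      ring
    rw [h2, h1, sub_mul, one_mul, mul_sub, map_sub,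
      show qProd 1 * (C x * X ^ (2 * M + 2) * ∑ᶠ k, tripleProductTerm x (2 * M + 2) k) =
        (qProd 1 * C x * ∑ᶠ k, tripleProductTerm x (2 * M + 2) k) * X ^ (2 * M + 2) by ring,
      PowerSeries.coeff_mul_X_pow', if_neg (by omega), sub_zero]
  ext M
  rw [hprod M M le_rfl]
  dsimp only
  rw [latticeSeries, PowerSeries.coeff_mk,
    finsum_eq_sum_of_support_subset _ (support_tripleProductTerm x (2 * M + 2)), Finset.mul_sum,
    map_sum, finsum_eq_sum_of_support_subset (s := Finset.Icc (-(2 * M + 2 : ℕ) : ℤ) (2 * M + 2 : ℕ))]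
  · refine Finset.sum_congr rfl fun k hk => ?_
    exact coeff_qProd_one_mul_tripleProductTerm hx le_rfl (abs_le.mpr (Finset.mem_Icc.mp hk))
  · intro k hk
    simp only [Function.mem_support, ne_eq, ite_eq_right_iff, not_forall] at hk
    have t0 := two_mul_triangle k
    rw [hk.1] at t0
    rw [Finset.coe_Icc]
    constructor <;> push_cast <;> nlinarith

end

/-! ### The series `η` and `θ` -/

section

open PowerSeries

/-- The series `∑ p, (-1)^p Q^((6p+1)^2)`. In the variable `q = Q^24` this is the Dedekind eta
function `q^(1/24) ∏ (1 - q^n)`. -/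
noncomputable def etaSeries : PowerSeries ℂ :=
  latticeSeries (fun p : ℤ => (-1 : ℂ) ^ p) fun p => (6 * p + 1) ^ 2

/-- The series `∑ n, (-x)^n Q^(3(2n-1)^2)`. In the variable `q = Q^24` this is the Jacobi theta
function `q^(1/8) (1 - x) ∏ (1 - q^n) (1 - x q^n) (1 - x⁻¹ q^n)`, which differs from the odd one by
the monomial `x^(1/2)`. -/
noncomputable def thetaSeries (x : ℂ) : PowerSeries ℂ :=
  latticeSeries (fun n : ℤ => (-1 : ℂ) ^ n * x ^ n) fun n => 3 * (2 * n - 1) ^ 2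

theorem neg_one_zpow_sq (n : ℤ) : ((-1 : ℂ) ^ n) * (-1) ^ n = 1 := by
  rw [← zpow_add₀ (by norm_num), Even.neg_one_zpow ⟨n, rfl⟩]

theorem admissible_eta : Admissible (fun p : ℤ => (-1 : ℂ) ^ p) fun p => (6 * p + 1) ^ 2 :=
  Admissible.of_abs_le id Function.injective_id fun p => by
    rw [id, abs_le]; constructor <;> nlinarith [sq_nonneg p, sq_nonneg (p + 1)]

theorem admissible_theta (x : ℂ) :
    Admissible (fun n : ℤ => (-1 : ℂ) ^ n * x ^ n) fun n => 3 * (2 * n - 1) ^ 2 :=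
  Admissible.of_abs_le id Function.injective_id fun p => by
    rw [id, abs_le]
    rcases le_or_gt p 0 with h | h
    · constructor <;> nlinarith
    · constructor <;> nlinarith

theorem X_pow_mul_latticeSeries {ι R : Type*} [CommRing R] {c : ι → R} {e : ι → ℤ}
    (h : ∀ i, c i ≠ 0 → 0 ≤ e i) (m : ℕ) :
    X ^ m * latticeSeries c e = latticeSeries c fun i => m + e i := by
  ext N
  rw [coeff_X_pow_mul']
  split_ifs with hm
  · simp only [latticeSeries, coeff_mk]
    refine finsum_congr fun i => ?_
    congr 1
    rw [Nat.cast_sub hm]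
    exact propext ⟨fun h => by omega, fun h => by omega⟩
  · simp only [latticeSeries, coeff_mk]
    symm
    apply finsum_eq_zero_of_forall_eq_zero
    intro i
    by_cases hc : c i = 0
    · simp [hc]
    · have := h i hc
      rw [if_neg (by omega)]

theorem thetaSeries_eq_prod {x : ℂ} (hx : x ≠ 0) :
    thetaSeries x = C (1 - x) * X ^ 3 *
      expand 24 (by norm_num) (qProd 1 * qProd x * qProd x⁻¹) := by
  have h : C (1 - x) * X ^ 3 * expand 24 (by norm_num) (qProd 1 * qProd x * qProd x⁻¹) =
      X ^ 3 * expand 24 (by norm_num) (C (1 - x) * (qProd 1 * qProd x * qProd x⁻¹)) := by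
    rw [map_mul (expand 24 _) (C (1 - x)), expand_C]
    ring
  rw [h, jacobi_triple_product hx, expand_latticeSeries,
    X_pow_mul_latticeSeries (fun i _ => by positivity)]
  refine latticeSeries_congr (fun n => ?_) fun n _ => ?_
  · rw [← mul_zpow]; simp
  · have := two_mul_triangle n
    push_cast
    linear_combination (-12) * this

theorem thetaSeries_one : thetaSeries 1 = 0 := by
  rw [thetaSeries_eq_prod one_ne_zero]
  simp

theorem qProd_one_eq_pentagonalSeries : qProd (1 : ℂ) = pentagonalSeries ℂ := by
  ext N
  obtain ⟨s, hs⟩ := Filter.eventually_atTop.mp (coeff_prod_one_sub_X_pow_eventually_eq ℂ N)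
  obtain ⟨M, hM⟩ := s.exists_nat_subset_range
  rw [← hs (Finset.range (max M N)) (hM.trans (Finset.range_mono (le_max_left _ _))),
    hasTruncations_qProd 1 N (max M N) (le_max_right _ _)]
  congr 1
  generalize max M N = m
  induction m with
  | zero => simp
  | succ m ih =>
    dsimp only at ih ⊢
    rw [Finset.prod_Icc_succ_top (by omega), Finset.prod_range_succ, ih]
    simp

theorem etaSeries_eq_prod : etaSeries = X * expand 24 (by norm_num) (qProd (1 : ℂ)) := by
  have h : qProd (1 : ℂ) = latticeSeries (fun k : ℤ => (-1 : ℂ) ^ k) fun k => pentagonal k := by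
    rw [qProd_one_eq_pentagonalSeries]
    ext N
    rw [latticeSeries, coeff_mk]
    by_cases hN : N ∈ Set.range pentagonal
    · obtain ⟨k, rfl⟩ := hN
      rw [coeff_pentagonalSeries_pentagonal, finsum_eq_single _ k]
      · rw [if_pos rfl, ← Int.cast_negOnePow ℂ k]
      · intro j hj
        rw [if_neg]
        simpa [pentagonal_inj] using hj
    · rw [coeff_pentagonalSeries_eq_zero ℂ hN, finsum_eq_zero_of_forall_eq_zero]
      intro k
      rw [if_neg]
      intro hk
      exact hN ⟨k, by exact_mod_cast hk⟩
  rw [h, expand_latticeSeries, ← pow_one X, X_pow_mul_latticeSeries (fun i _ => by positivity),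
    etaSeries, ← latticeSeries_comp (fun p : ℤ => -p) neg_injective fun j _ => ⟨-j, neg_neg j⟩]
  refine latticeSeries_congr (fun n => ?_) fun n _ => ?_
  · rw [zpow_neg]
    exact (inv_eq_of_mul_eq_one_left (neg_one_zpow_sq n))
  · have := two_mul_natCast_pentagonal n
    push_cast
    linear_combination (-12) * this

theorem etaSeries_ne_zero : etaSeries ≠ 0 := by
  rw [etaSeries_eq_prod]
  refine mul_ne_zero X_ne_zero fun h => ?_
  have := congrArg constantCoeff h
  rw [constantCoeff_expand, constantCoeff_qProd, map_zero] at this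
  exact one_ne_zero this

/-! ### Summation along a line -/

/-- The ratio of `∑ p, (-1)^p Q^((6p+1-2d)^2)` to `η`. -/
noncomputable def lineSign (d : ℤ) : ℂ := if d % 3 = 2 then 0 else (-1) ^ (d / 3)

variable {ι : Type*} {c : ι → ℂ} {d g : ι → ℤ}

theorem Admissible.lineSign
    (h : Admissible (fun q : ι × ℤ => c q.1 * (-1) ^ q.2)
      fun q => (6 * q.2 + 1 - 2 * d q.1) ^ 2 + g q.1)
    (hg : ∀ i, c i ≠ 0 → 0 ≤ g i) : Admissible (fun i => c i * lineSign (d i)) g := by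
  refine ⟨fun i hi => hg i (left_ne_zero_of_mul hi), fun N => ?_⟩
  have h1 := h.comp (fun i => (i, d i / 3)) fun i j hij => (Prod.ext_iff.mp hij).1
  refine (h1.finite (N + 1)).subset ?_
  rintro i ⟨hc, hN⟩
  refine ⟨mul_ne_zero (left_ne_zero_of_mul hc) (zpow_ne_zero _ (by norm_num)), ?_⟩
  have h2 : d i % 3 ≠ 2 := fun h => by simp [_root_.lineSign, h] at hc
  have h3 : 6 * (d i / 3) + 1 - 2 * d i = 1 ∨ 6 * (d i / 3) + 1 - 2 * d i = -1 := by omega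
  dsimp only
  rcases h3 with h3 | h3 <;> rw [h3] <;> linarith

/-- Summing over `p` in a series that depends on `p` through `(-1)^p Q^((6p+1-2d)^2)` splits off a
factor `η`: for `d ≢ 2 (mod 3)` a translation, possibly followed by `p ↦ -p`, identifies the sum
with `±η`, and for `d ≡ 2 (mod 3)` the terms cancel in pairs. -/
theorem latticeSeries_eq_etaSeries_mul
    (h : Admissible (fun q : ι × ℤ => c q.1 * (-1) ^ q.2)
      fun q => (6 * q.2 + 1 - 2 * d q.1) ^ 2 + g q.1)
    (hg : ∀ i, c i ≠ 0 → 0 ≤ g i) :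
    latticeSeries (fun q : ι × ℤ => c q.1 * (-1) ^ q.2)
      (fun q => (6 * q.2 + 1 - 2 * d q.1) ^ 2 + g q.1) =
      etaSeries * latticeSeries (fun i => c i * lineSign (d i)) g := by
  have hm1 : (-1 : ℂ) ≠ 0 := by norm_num
  have a1 : Admissible (fun q : ι × ℤ => (if d q.1 % 3 = 2 then 0 else c q.1) * (-1) ^ q.2)
      fun q => (6 * q.2 + 1 - 2 * d q.1) ^ 2 + g q.1 := by
    refine h.of_support fun q hq hq' => hq ?_
    split_ifs
    · simp
    · exact hq'
  have a2 : Admissible (fun q : ι × ℤ => (if d q.1 % 3 = 2 then c q.1 else 0) * (-1) ^ q.2)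
      fun q => (6 * q.2 + 1 - 2 * d q.1) ^ 2 + g q.1 := by
    refine h.of_support fun q hq hq' => hq ?_
    split_ifs
    · exact hq'
    · simp
  have z2 : latticeSeries (fun q : ι × ℤ => (if d q.1 % 3 = 2 then c q.1 else 0) * (-1) ^ q.2)
      (fun q => (6 * q.2 + 1 - 2 * d q.1) ^ 2 + g q.1) = 0 := by
    refine latticeSeries_eq_zero_of_antisymm
      ⟨fun q => (q.1, 2 * (d q.1 / 3) + 1 - q.2), fun q => (q.1, 2 * (d q.1 / 3) + 1 - q.2),
        fun q => by simp, fun q => by simp⟩ (fun q => ?_) fun q hq => ?_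
    · simp only [Equiv.coe_fn_mk]
      have : (-1 : ℂ) ^ (2 * (d q.1 / 3) + 1 - q.2) = -(-1) ^ q.2 := by
        rw [zpow_sub₀ hm1, Odd.neg_one_zpow ⟨_, rfl⟩, div_eq_iff (zpow_ne_zero _ hm1)]
        linear_combination neg_one_zpow_sq q.2
      rw [this]
      ring
    · have h2 : d q.1 % 3 = 2 := by
        by_contra h2
        simp [h2] at hq
      simp only [Equiv.coe_fn_mk]
      have : d q.1 = 3 * (d q.1 / 3) + 2 := by omega
      generalize d q.1 / 3 = w at *
      rw [this]
      ring
  have s : latticeSeries (fun q : ι × ℤ => c q.1 * (-1) ^ q.2)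
      (fun q => (6 * q.2 + 1 - 2 * d q.1) ^ 2 + g q.1) =
      latticeSeries (fun q : ι × ℤ => (if d q.1 % 3 = 2 then 0 else c q.1) * (-1) ^ q.2)
      (fun q => (6 * q.2 + 1 - 2 * d q.1) ^ 2 + g q.1) := by
    rw [← add_zero (latticeSeries (fun q : ι × ℤ => (if d q.1 % 3 = 2 then 0 else c q.1) *
      (-1) ^ q.2) _), ← z2, latticeSeries_add a1 a2]
    refine latticeSeries_congr (fun q => ?_) fun _ _ => rfl
    split_ifs <;> simp
  rw [s, mul_comm, etaSeries, latticeSeries_mul (h.lineSign hg) admissible_eta,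
    ← latticeSeries_comp (fun q : ι × ℤ =>
      (q.1, if d q.1 % 3 = 1 then d q.1 / 3 - q.2 else d q.1 / 3 + q.2))]
  · refine latticeSeries_congr (fun q => ?_) fun q hq => ?_
    · dsimp only
      rw [lineSign]
      split_ifs with h1 h2
      · simp
      · simp
      · rw [zpow_sub₀ hm1, mul_assoc]
        congr 1
        rw [div_eq_iff (zpow_ne_zero _ hm1), mul_assoc, neg_one_zpow_sq, mul_one]
      · rw [zpow_add₀ hm1]
        ring
    · dsimp only at hq ⊢
      have h2 : d q.1 % 3 ≠ 2 := fun h => by simp [h] at hq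
      rcases (by omega : d q.1 % 3 = 0 ∨ d q.1 % 3 = 1) with h3 | h3
      · have : d q.1 = 3 * (d q.1 / 3) := by omega
        rw [if_neg (by omega)]
        generalize d q.1 / 3 = w at *
        rw [this]
        ring
      · have : d q.1 = 3 * (d q.1 / 3) + 1 := by omega
        rw [if_pos h3]
        generalize d q.1 / 3 = w at *
        rw [this]
        ring
  · rintro ⟨i, p⟩ ⟨j, r⟩ hij
    simp only [Prod.mk.injEq] at hij
    obtain ⟨rfl, h2⟩ := hij
    ext
    · rfl
    · split_ifs at h2 <;> dsimp only <;> omega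
  · rintro ⟨i, p⟩ -
    refine ⟨(i, if d i % 3 = 1 then d i / 3 - p else p - d i / 3), ?_⟩
    ext
    · rfl
    · dsimp only
      split_ifs <;> omega

end

section

open PowerSeries

/-- A series over a lattice that fibres into lines, along each of which the exponents and the signs
are those of a translate of `η`, is `η` times a series over the base. -/
theorem latticeSeries_fibration {ι κ : Type*} {C : κ → ℂ} {E : κ → ℤ} (hA : Admissible C E)
    {c : ι → ℂ} {d g : ι → ℤ} (f : ι × ℤ → κ) (hf : Function.Injective f)
    (hr : ∀ j, C j ≠ 0 → j ∈ Set.range f) (hC : ∀ q, C (f q) = c q.1 * (-1) ^ q.2)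
    (hE : ∀ q, c q.1 ≠ 0 → E (f q) = (6 * q.2 + 1 - 2 * d q.1) ^ 2 + g q.1)
    (hg : ∀ i, c i ≠ 0 → 0 ≤ g i) :
    Admissible (fun i => c i * lineSign (d i)) g ∧
      latticeSeries C E = etaSeries * latticeSeries (fun i => c i * lineSign (d i)) g := by
  have h1 := hA.comp f hf
  have h2 : Admissible (fun q : ι × ℤ => c q.1 * (-1) ^ q.2)
      fun q => (6 * q.2 + 1 - 2 * d q.1) ^ 2 + g q.1 := by
    refine ⟨fun q hq => ?_, fun N => (h1.finite N).subset ?_⟩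
    · rw [← hE q (left_ne_zero_of_mul hq)]
      exact h1.nonneg q (by rwa [hC])
    · rintro q ⟨hq, hN⟩
      refine ⟨by rwa [hC], ?_⟩
      rw [hE q (left_ne_zero_of_mul hq)]
      exact hN
  refine ⟨h2.lineSign hg, ?_⟩
  rw [← latticeSeries_eq_etaSeries_mul h2 hg, ← latticeSeries_comp f hf hr]
  exact latticeSeries_congr hC fun q hq => hE q (by rw [hC] at hq; exact left_ne_zero_of_mul hq)

theorem neg_one_zpow_sub (a b : ℤ) : (-1 : ℂ) ^ (a - b) = (-1) ^ a * (-1) ^ b := by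
  rw [zpow_sub₀ (by norm_num), div_eq_iff (zpow_ne_zero _ (by norm_num)), mul_assoc,
    neg_one_zpow_sq, mul_one]

/-! ### The denominator identities of types `A₂` and `B₂` -/

/-- The denominator identity of type `A₂`: the product over the positive roots is a series over the
root lattice. -/
theorem theta_mul_A₂ {x y : ℂ} (hx : x ≠ 0) (hy : y ≠ 0) :
    thetaSeries x * thetaSeries y * thetaSeries (x * y) = etaSeries * latticeSeries
      (fun q : ℤ × ℤ => (-1) ^ (q.1 + q.2) * lineSign (q.1 + q.2) * (x ^ q.1 * y ^ q.2))
      (fun q => 8 * (q.1 ^ 2 + q.2 ^ 2 - q.1 * q.2 - q.1 - q.2 + 1)) := by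
  have a2 := (admissible_theta x).mul (admissible_theta y)
  have a3 := a2.mul (admissible_theta (x * y))
  rw [thetaSeries, thetaSeries, thetaSeries,
    latticeSeries_mul (admissible_theta x) (admissible_theta y),
    latticeSeries_mul a2 (admissible_theta (x * y)),
    (latticeSeries_fibration a3 (ι := ℤ × ℤ)
      (c := fun q => (-1) ^ (q.1 + q.2) * (x ^ q.1 * y ^ q.2))
      (d := fun q => q.1 + q.2)
      (g := fun q => 8 * (q.1 ^ 2 + q.2 ^ 2 - q.1 * q.2 - q.1 - q.2 + 1))
      (fun q => ((q.1.1 - q.2, q.1.2 - q.2), q.2)) ?_ ?_ ?_ ?_ ?_).2]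
  · congr 2
    ext q
    ring
  · rintro ⟨⟨s, t⟩, p⟩ ⟨⟨s', t'⟩, p'⟩ h
    simp only [Prod.mk.injEq] at h ⊢
    omega
  · rintro ⟨⟨l, m⟩, p⟩ -
    exact ⟨((l + p, m + p), p), by simp⟩
  · rintro ⟨⟨s, t⟩, p⟩
    simp only [neg_one_zpow_sub, zpow_sub₀ hx, zpow_sub₀ hy, mul_zpow,
      zpow_add₀ (show (-1 : ℂ) ≠ 0 by norm_num)]
    have hxp : x ^ p ≠ 0 := zpow_ne_zero _ hx
    have hyp : y ^ p ≠ 0 := zpow_ne_zero _ hy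
    field_simp
    linear_combination neg_one_zpow_sq p
  · rintro ⟨⟨s, t⟩, p⟩ -
    ring
  · rintro ⟨s, t⟩ -
    nlinarith [sq_nonneg (s - t), sq_nonneg (s - 1), sq_nonneg (t - 1)]

/-- The denominator identity of type `B₂` (Winquist's identity). -/
theorem theta_mul_B₂ {x y : ℂ} (hx : x ≠ 0) (hy : y ≠ 0) :
    thetaSeries x * thetaSeries y * thetaSeries (x * y) * thetaSeries (x / y) =
      etaSeries ^ 2 * latticeSeries
      (fun q : ℤ × ℤ => (-1) ^ (q.1 + q.2) * lineSign (q.1 + q.2) * lineSign (q.2 - q.1) *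
        (x ^ q.1 * y ^ q.2))
      (fun q => (2 * q.1 - 3) ^ 2 + (2 * q.2 - 1) ^ 2) := by
  have a2 := (admissible_theta x).mul (admissible_theta y)
  have a3 := a2.mul (admissible_theta (x * y))
  have a4 := a3.mul (admissible_theta (x / y))
  have h1 := latticeSeries_fibration a4 (ι := (ℤ × ℤ) × ℤ)
      (c := fun q => (-1) ^ (q.1.1 + q.1.2) * (x ^ q.1.1 * y ^ q.1.2) * (-1) ^ q.2)
      (d := fun q => q.1.1 + q.1.2)
      (g := fun q => (6 * q.2 + 1 - 2 * (q.1.2 - q.1.1)) ^ 2 +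
        ((2 * q.1.1 - 3) ^ 2 + (2 * q.1.2 - 1) ^ 2))
      (fun q => (((q.1.1.1 - q.2 + q.1.2, q.1.1.2 - q.2 - q.1.2), q.2), -q.1.2))
      (by
        rintro ⟨⟨⟨s, t⟩, r⟩, p⟩ ⟨⟨⟨s', t'⟩, r'⟩, p'⟩ h
        simp only [Prod.mk.injEq] at h ⊢
        omega)
      (by
        rintro ⟨⟨⟨l, m⟩, p⟩, r⟩ -
        exact ⟨(((l + p + r, m + p - r), -r), p), by simp; omega⟩)
      (by
        rintro ⟨⟨⟨s, t⟩, r⟩, p⟩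
        simp only [neg_one_zpow_sub, zpow_sub₀ hx, zpow_sub₀ hy, mul_zpow,
          div_zpow, zpow_add₀ (show (-1 : ℂ) ≠ 0 by norm_num), zpow_add₀ hx, zpow_neg]
        have hxp : x ^ p ≠ 0 := zpow_ne_zero _ hx
        have hyp : y ^ p ≠ 0 := zpow_ne_zero _ hy
        have hxr : x ^ r ≠ 0 := zpow_ne_zero _ hx
        have hyr : y ^ r ≠ 0 := zpow_ne_zero _ hy
        have e1 := neg_one_zpow_sq p
        generalize (-1 : ℂ) ^ p = P at *
        generalize (-1 : ℂ) ^ r = R at *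
        field_simp
        linear_combination P * R * e1)
      (by
        rintro ⟨⟨⟨s, t⟩, r⟩, p⟩ -
        ring)
      (fun q _ => by positivity)
  have h2 := latticeSeries_fibration h1.1 (ι := ℤ × ℤ)
      (c := fun q => (-1) ^ (q.1 + q.2) * (x ^ q.1 * y ^ q.2) * lineSign (q.1 + q.2))
      (d := fun q => q.2 - q.1)
      (g := fun q => (2 * q.1 - 3) ^ 2 + (2 * q.2 - 1) ^ 2) id Function.injective_id
      (fun j _ => ⟨j, rfl⟩) (fun q => by simp only [id]; ring) (fun q _ => rfl)
      (fun q _ => by positivity)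
  rw [thetaSeries, thetaSeries, thetaSeries, thetaSeries,
    latticeSeries_mul (admissible_theta x) (admissible_theta y),
    latticeSeries_mul a2 (admissible_theta (x * y)),
    latticeSeries_mul a3 (admissible_theta (x / y)), h1.2, h2.2, ← mul_assoc, ← sq]
  congr 2
  ext q
  ring

end

/-! ### The denominator identity of type `G₂` -/

section

open PowerSeries

/-- The series `∑ j, χ j * a^j Q^(m j^2)`. -/
noncomputable def weightedTheta (m : ℤ) (χ : ℤ → ℂ) (a : ℂ) : PowerSeries ℂ :=
  latticeSeries (fun j : ℤ => χ j * a ^ j) fun j => m * j ^ 2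

/-- The indicator function of the residue class of `r` modulo `n`. -/
noncomputable def residueIndicator (n r j : ℤ) : ℂ := if j % n = r then 1 else 0

theorem admissible_sq {m : ℤ} (hm : 0 < m) (c : ℤ → ℂ) : Admissible c fun j => m * j ^ 2 :=
  Admissible.of_abs_le id Function.injective_id fun p => by
    rw [id, ← sq_abs]
    have : 0 ≤ |p| := abs_nonneg p
    rcases this.eq_or_lt with h | h
    · rw [← h]; simp
    · nlinarith [mul_le_mul_of_nonneg_left (show 1 ≤ m from hm) (sq_nonneg |p|)]

theorem admissible_sq_add_sq {m : ℤ} (hm : 0 < m) (c : ℤ × ℤ → ℂ) :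
    Admissible c fun q => m * q.1 ^ 2 + m * q.2 ^ 2 :=
  ((admissible_sq hm fun _ => 1).mul (admissible_sq hm fun _ => 1)).of_support (by simp)

theorem admissible_sq_add_sq_add_sq {m : ℤ} (hm : 0 < m) (c : (ℤ × ℤ) × ℤ → ℂ) :
    Admissible c fun q => m * q.1.1 ^ 2 + m * q.1.2 ^ 2 + m * q.2 ^ 2 :=
  ((admissible_sq_add_sq hm fun _ => 1).mul (admissible_sq hm fun _ => 1)).of_support (by simp)

theorem weightedTheta_mul {m : ℤ} (hm : 0 < m) (χ ψ : ℤ → ℂ) (a b : ℂ) :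
    weightedTheta m χ a * weightedTheta m ψ b =
      latticeSeries (fun q : ℤ × ℤ => χ q.1 * a ^ q.1 * (ψ q.2 * b ^ q.2))
        fun q => m * q.1 ^ 2 + m * q.2 ^ 2 :=
  latticeSeries_mul (admissible_sq hm _) (admissible_sq hm _)

theorem weightedTheta_mul_mul {m : ℤ} (hm : 0 < m) (χ ψ ω : ℤ → ℂ) (a b c : ℂ) :
    weightedTheta m χ a * weightedTheta m ψ b * weightedTheta m ω c =
      latticeSeries (fun q : (ℤ × ℤ) × ℤ =>
        χ q.1.1 * a ^ q.1.1 * (ψ q.1.2 * b ^ q.1.2) * (ω q.2 * c ^ q.2))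
        fun q => m * q.1.1 ^ 2 + m * q.1.2 ^ 2 + m * q.2 ^ 2 := by
  rw [weightedTheta_mul hm]
  exact latticeSeries_mul (admissible_sq_add_sq hm _) (admissible_sq hm _)

theorem latticeSeries_sub {ι : Type*} {c₁ c₂ : ι → ℂ} {e : ι → ℤ} (h₁ : Admissible c₁ e)
    (h₂ : Admissible c₂ e) :
    latticeSeries c₁ e - latticeSeries c₂ e = latticeSeries (fun i => c₁ i - c₂ i) e := by
  rw [sub_eq_add_neg, latticeSeries_neg,
    latticeSeries_add h₁ (h₂.of_support fun i hi => neg_ne_zero.mp hi)]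
  simp only [sub_eq_add_neg]

/-- The even part `∑ a^j Q^(6j^2)`, over even `j`. -/
noncomputable abbrev evenTheta (a : ℂ) : PowerSeries ℂ := weightedTheta 6 (residueIndicator 2 0) a

/-- The odd part `∑ a^j Q^(6j^2)`, over odd `j`. -/
noncomputable abbrev oddTheta (a : ℂ) : PowerSeries ℂ := weightedTheta 6 (residueIndicator 2 1) a

/-- The addition formula: sums and differences of the two summation indices have the same parity. -/
theorem theta_mul_theta {a b : ℂ} (ha : a ≠ 0) (hb : b ≠ 0) :
    thetaSeries (a * b) * thetaSeries (a / b) =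
      C a * (oddTheta a * evenTheta b - evenTheta a * oddTheta b) := by
  rw [weightedTheta_mul (by norm_num), weightedTheta_mul (by norm_num),
    latticeSeries_sub (admissible_sq_add_sq (by norm_num) _)
      (admissible_sq_add_sq (by norm_num) _),
    C_mul_latticeSeries (admissible_sq_add_sq (by norm_num) _), thetaSeries, thetaSeries,
    latticeSeries_mul (admissible_theta _) (admissible_theta _)]
  symm
  rw [← latticeSeries_comp (fun q : ℤ × ℤ => (q.1 + q.2 - 1, q.1 - q.2))]
  · symm
    refine latticeSeries_congr (fun q => ?_) fun q _ => ?_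
    · obtain ⟨m, n⟩ := q
      have h1 : (a * b) ^ m * (a / b) ^ n = a * (a ^ (m + n - 1) * b ^ (m - n)) := by
        rw [mul_zpow, div_zpow, zpow_sub₀ ha, zpow_add₀ ha, zpow_sub₀ hb, zpow_one]
        field_simp
      have h2 : (-1 : ℂ) ^ m * (-1) ^ n =
          residueIndicator 2 1 (m + n - 1) * residueIndicator 2 0 (m - n) -
          residueIndicator 2 0 (m + n - 1) * residueIndicator 2 1 (m - n) := by
        rw [← zpow_add₀ (by norm_num)]
        rcases Int.even_or_odd (m + n) with h | h
        · rw [h.neg_one_zpow]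
          obtain ⟨k, hk⟩ := h
          simp only [residueIndicator]
          split_ifs <;> first | omega | norm_num
        · rw [h.neg_one_zpow]
          obtain ⟨k, hk⟩ := h
          simp only [residueIndicator]
          split_ifs <;> first | omega | norm_num
      dsimp only
      linear_combination (-1) ^ m * (-1) ^ n * h1 + a * (a ^ (m + n - 1) * b ^ (m - n)) * h2
    · ring
  · rintro ⟨m, n⟩ ⟨m', n'⟩ h
    simp only [Prod.mk.injEq] at h ⊢
    omega
  · rintro ⟨s, d⟩ h
    have : (s + d) % 2 = 1 := by
      by_contra h3
      apply h
      simp only [residueIndicator]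
      split_ifs <;> first | omega | norm_num
    refine ⟨((s + 1 + d) / 2, (s + 1 - d) / 2), ?_⟩
    simp only [Prod.mk.injEq]
    omega

/-- Products of two series with the same argument, in terms of the sum and the difference of the
summation indices. -/
theorem weightedTheta_mul_self {a : ℂ} (ha : a ≠ 0) (w χ ψ : ℤ → ℤ → ℂ)
    (hw : ∀ i j, w (i - j) (i + j) = χ i j * ψ i j)
    (h0 : ∀ d s, w d s ≠ 0 → d % 2 = s % 2) :
    latticeSeries (fun q : ℤ × ℤ => χ q.1 q.2 * a ^ q.1 * (ψ q.1 q.2 * a ^ q.2))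
      (fun q => 6 * q.1 ^ 2 + 6 * q.2 ^ 2) =
    latticeSeries (fun q : ℤ × ℤ => w q.1 q.2 * a ^ q.2) fun q => 3 * q.1 ^ 2 + 3 * q.2 ^ 2 := by
  rw [← latticeSeries_comp (c' := fun q : ℤ × ℤ => w q.1 q.2 * a ^ q.2)
    (fun q : ℤ × ℤ => (q.1 - q.2, q.1 + q.2))]
  · refine latticeSeries_congr (fun q => ?_) fun q _ => by ring
    dsimp only
    rw [hw, zpow_add₀ ha]
    ring
  · rintro ⟨m, n⟩ ⟨m', n'⟩ h
    simp only [Prod.mk.injEq] at h ⊢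
    omega
  · rintro ⟨d, s⟩ h
    have := h0 d s (left_ne_zero_of_mul h)
    refine ⟨((s + d) / 2, (s - d) / 2), ?_⟩
    simp only [Prod.mk.injEq]
    omega

/-- The series `∑ a^j Q^(3j^2)`, over `j ≡ r (mod 4)`. -/
noncomputable abbrev quarterTheta (r : ℤ) (a : ℂ) : PowerSeries ℂ :=
  weightedTheta 3 (residueIndicator 4 r) a

/-- The series `∑ a^j Q^(3j^2)`, over odd `j`. -/
noncomputable abbrev halfTheta (a : ℂ) : PowerSeries ℂ := weightedTheta 3 (residueIndicator 2 1) a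

theorem evenTheta_sq {a : ℂ} (ha : a ≠ 0) : evenTheta a * evenTheta a =
    quarterTheta 0 1 * quarterTheta 0 a + quarterTheta 2 1 * quarterTheta 2 a := by
  rw [weightedTheta_mul (by norm_num), weightedTheta_mul (by norm_num),
    weightedTheta_mul (by norm_num),
    latticeSeries_add (admissible_sq_add_sq (by norm_num) _)
      (admissible_sq_add_sq (by norm_num) _),
    weightedTheta_mul_self ha (fun d s => residueIndicator 4 0 d * residueIndicator 4 0 s +
      residueIndicator 4 2 d * residueIndicator 4 2 s) (fun i _ => residueIndicator 2 0 i)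
      (fun _ j => residueIndicator 2 0 j)]
  · refine latticeSeries_congr (fun q => ?_) fun q _ => rfl
    simp only [one_zpow]
    ring
  · intro i j
    simp only [residueIndicator]
    split_ifs <;> first | omega | norm_num
  · intro d s h
    by_contra h2
    apply h
    simp only [residueIndicator]
    split_ifs <;> first | omega | norm_num

theorem oddTheta_sq {a : ℂ} (ha : a ≠ 0) : oddTheta a * oddTheta a =
    quarterTheta 2 1 * quarterTheta 0 a + quarterTheta 0 1 * quarterTheta 2 a := by
  rw [weightedTheta_mul (by norm_num), weightedTheta_mul (by norm_num),
    weightedTheta_mul (by norm_num),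
    latticeSeries_add (admissible_sq_add_sq (by norm_num) _)
      (admissible_sq_add_sq (by norm_num) _),
    weightedTheta_mul_self ha (fun d s => residueIndicator 4 2 d * residueIndicator 4 0 s +
      residueIndicator 4 0 d * residueIndicator 4 2 s) (fun i _ => residueIndicator 2 1 i)
      (fun _ j => residueIndicator 2 1 j)]
  · refine latticeSeries_congr (fun q => ?_) fun q _ => rfl
    simp only [one_zpow]
    ring
  · intro i j
    simp only [residueIndicator]
    split_ifs <;> first | omega | norm_num
  · intro d s h
    by_contra h2
    apply h
    simp only [residueIndicator]
    split_ifs <;> first | omega | norm_num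

theorem two_mul_evenTheta_mul_oddTheta {a : ℂ} (ha : a ≠ 0) :
    2 * (evenTheta a * oddTheta a) = halfTheta 1 * halfTheta a := by
  rw [two_mul]
  nth_rw 2 [mul_comm]
  rw [weightedTheta_mul (by norm_num), weightedTheta_mul (by norm_num),
    weightedTheta_mul (by norm_num),
    latticeSeries_add (admissible_sq_add_sq (by norm_num) _)
      (admissible_sq_add_sq (by norm_num) _)]
  rw [show (fun q : ℤ × ℤ => residueIndicator 2 0 q.1 * a ^ q.1 *
      (residueIndicator 2 1 q.2 * a ^ q.2) + residueIndicator 2 1 q.1 * a ^ q.1 *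
      (residueIndicator 2 0 q.2 * a ^ q.2)) = fun q : ℤ × ℤ =>
      (residueIndicator 2 0 q.1 * residueIndicator 2 1 q.2 +
        residueIndicator 2 1 q.1 * residueIndicator 2 0 q.2) * a ^ q.1 * (1 * a ^ q.2) by
      ext q; ring]
  rw [weightedTheta_mul_self ha (fun d s => residueIndicator 2 1 d * residueIndicator 2 1 s)
      (fun i j => residueIndicator 2 0 i * residueIndicator 2 1 j +
        residueIndicator 2 1 i * residueIndicator 2 0 j) (fun _ _ => 1)]
  · refine latticeSeries_congr (fun q => ?_) fun q _ => rfl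
    simp only [one_zpow]
    ring
  · intro i j
    simp only [residueIndicator]
    split_ifs <;> first | omega | norm_num
  · intro d s h
    by_contra h2
    apply h
    simp only [residueIndicator]
    split_ifs <;> first | omega | norm_num

theorem oddTheta_I : oddTheta Complex.I = 0 := by
  refine latticeSeries_eq_zero_of_antisymm (Equiv.neg ℤ) (fun j => ?_) fun j _ => by simp
  simp only [Equiv.neg_apply, residueIndicator]
  split_ifs with h1 h2 h2
  · have : Complex.I ^ (-j) = -Complex.I ^ j := by
      obtain ⟨k, rfl⟩ : ∃ k, j = 2 * k + 1 := ⟨j / 2, by omega⟩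
      rw [zpow_neg, zpow_add₀ Complex.I_ne_zero, zpow_mul, zpow_one]
      have : (Complex.I ^ (2 : ℤ)) = -1 := by
        rw [zpow_ofNat]; exact Complex.I_sq
      rw [this, mul_inv, Complex.inv_I,
        inv_eq_of_mul_eq_one_left (neg_one_zpow_sq k)]
      ring
    rw [this]
    ring
  · omega
  · omega
  · simp

theorem evenTheta_I_sq : evenTheta Complex.I * evenTheta Complex.I =
    quarterTheta 0 1 ^ 2 - quarterTheta 2 1 ^ 2 := by
  have hI2 : (Complex.I ^ (2 : ℤ)) = -1 := by
    rw [zpow_ofNat]; exact Complex.I_sq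
  have h0 : quarterTheta 0 Complex.I = quarterTheta 0 1 := by
    refine latticeSeries_congr (fun j => ?_) fun _ _ => rfl
    simp only [residueIndicator]
    split_ifs with h
    · obtain ⟨k, rfl⟩ : ∃ k, j = 2 * (2 * k) := ⟨j / 4, by omega⟩
      rw [zpow_mul, hI2, Even.neg_one_zpow (even_two_mul k), one_zpow]
    · simp
  have h2 : quarterTheta 2 Complex.I = -quarterTheta 2 1 := by
    unfold quarterTheta weightedTheta
    rw [latticeSeries_neg]
    refine latticeSeries_congr (fun j => ?_) fun _ _ => rfl
    simp only [residueIndicator]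
    split_ifs with h
    · obtain ⟨k, rfl⟩ : ∃ k, j = 2 * (2 * k + 1) := ⟨j / 4, by omega⟩
      rw [zpow_mul, hI2, Odd.neg_one_zpow ⟨k, rfl⟩, one_zpow]
      ring
    · simp
  rw [evenTheta_sq Complex.I_ne_zero, h0, h2]
  ring

theorem halfTheta_one : halfTheta 1 = thetaSeries (-1) := by
  unfold halfTheta weightedTheta
  rw [thetaSeries, ← latticeSeries_comp (c' := fun j : ℤ =>
    residueIndicator 2 1 j * (1 : ℂ) ^ j) (fun n : ℤ => 2 * n - 1)]
  · refine latticeSeries_congr (fun n => ?_) fun n _ => rfl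
    rw [neg_one_zpow_sq, residueIndicator, if_pos (by omega), one_zpow, one_mul]
  · intro m n h
    simp only at h
    omega
  · intro j hj
    have : j % 2 = 1 := by
      by_contra h
      simp [residueIndicator, h] at hj
    refine ⟨(j + 1) / 2, ?_⟩
    dsimp only
    omega

theorem oddTheta_one : oddTheta 1 = expand 2 (by norm_num) (thetaSeries (-1)) := by
  rw [← halfTheta_one]
  unfold oddTheta halfTheta weightedTheta
  rw [expand_latticeSeries]
  refine latticeSeries_congr (fun n => rfl) fun n _ => ?_
  push_cast
  ring

/-- `η^3` in terms of theta constants; this is the constant of proportionality in the Vandermonde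
form of the denominator identity of type `D₃`. -/
theorem thetaSeries_neg_one_mul_evenTheta_I_sq :
    thetaSeries (-1) * (evenTheta Complex.I * evenTheta Complex.I) = 2 * etaSeries ^ 3 := by
  have hI : Complex.I⁻¹ = -Complex.I := Complex.inv_I
  have h24 : (24 : ℕ) ≠ 0 := by norm_num
  have h2 : (2 : ℕ) ≠ 0 := by norm_num
  have e1 : qProd (1 : ℂ) * qProd (-1) = expand 2 h2 (qProd 1) := by
    have := prod_qProd_eq_expand Finset.univ (![1, -1] : Fin 2 → ℂ) 1 2 h2
      (fun y => by simp [Fin.prod_univ_two]; ring)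
    simpa [Fin.prod_univ_two] using this
  have e2 : qProd Complex.I * qProd (-Complex.I) = expand 2 h2 (qProd (-1)) := by
    have := prod_qProd_eq_expand Finset.univ (![Complex.I, -Complex.I] : Fin 2 → ℂ) (-1) 2 h2
      (fun y => by
        have : (C Complex.I : PowerSeries ℂ) * C Complex.I = -1 := by
          rw [← map_mul, Complex.I_mul_I, map_neg, map_one]
        simp [Fin.prod_univ_two]
        linear_combination -y ^ 2 * this)
    simpa [Fin.prod_univ_two] using this
  have ht1 : thetaSeries (-1) = 2 * X ^ 3 *
      expand 24 h24 (qProd 1 * qProd (-1) * qProd (-1)) := by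
    rw [thetaSeries_eq_prod (by norm_num), show ((-1 : ℂ))⁻¹ = -1 by norm_num,
      show (1 - -1 : ℂ) = 2 by norm_num, map_ofNat]
  have hCI : (C (1 - Complex.I) : PowerSeries ℂ) * C (1 - -Complex.I) = 2 := by
    rw [← map_mul, show (1 - Complex.I) * (1 - -Complex.I) = 2 by
      ring_nf; rw [Complex.I_sq]; norm_num, map_ofNat]
  have htI : thetaSeries Complex.I * thetaSeries (-Complex.I) = 2 * X ^ 6 *
      expand 24 h24 (qProd 1 * expand 2 h2 (qProd (-1))) ^ 2 := by
    rw [thetaSeries_eq_prod Complex.I_ne_zero,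
      thetaSeries_eq_prod (neg_ne_zero.mpr Complex.I_ne_zero), hI, inv_neg, hI, neg_neg, ← e2,
      ← hCI]
    simp only [map_mul]
    ring
  have ho : oddTheta 1 = 2 * X ^ 6 *
      expand 24 h24 (expand 2 h2 (qProd 1 * qProd (-1) * qProd (-1))) := by
    rw [oddTheta_one, ht1, map_mul, map_mul, map_pow, expand_X, map_ofNat, ← pow_mul,
      ← expand_mul, ← expand_mul]
  have hYX : thetaSeries Complex.I * thetaSeries (-Complex.I) =
      oddTheta 1 * evenTheta Complex.I := by
    have := theta_mul_theta one_ne_zero Complex.I_ne_zero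
    rw [oddTheta_I, one_mul, one_div, hI] at this
    rw [this, map_one]
    ring
  rw [htI, ho] at hYX
  rw [ht1, etaSeries_eq_prod]
  have hne : ∀ x : ℂ, expand 24 h24 (qProd x) ≠ 0 := fun x h => by
    have := congrArg constantCoeff h
    rw [constantCoeff_expand, constantCoeff_qProd, map_zero] at this
    exact one_ne_zero this
  have hne2 : expand 24 h24 (expand 2 h2 (qProd (-1 : ℂ))) ≠ 0 := fun h => by
    have := congrArg constantCoeff h
    rw [constantCoeff_expand, constantCoeff_expand, constantCoeff_qProd, map_zero] at this
    exact one_ne_zero this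
  have hX : (X : PowerSeries ℂ) ≠ 0 := X_ne_zero
  have h20 : (2 : PowerSeries ℂ) ≠ 0 := fun h => by
    have := congrArg constantCoeff h
    rw [map_ofNat, map_zero] at this
    exact two_ne_zero this
  simp only [map_mul, ← e1] at hYX ⊢
  have hkey : expand 24 h24 (qProd 1) = expand 24 h24 (qProd (-1)) * evenTheta Complex.I := by
    have hz : 2 * X ^ 6 * expand 24 h24 (expand 2 h2 (qProd (-1 : ℂ))) ^ 2 *
        expand 24 h24 (qProd 1) ≠ 0 :=
      mul_ne_zero (mul_ne_zero (mul_ne_zero h20 (pow_ne_zero _ hX)) (pow_ne_zero _ hne2)) (hne 1)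
    apply mul_left_cancel₀ hz
    linear_combination hYX
  linear_combination (-2 * X ^ 3 * expand 24 h24 (qProd 1)) *
    (expand 24 h24 (qProd 1) + expand 24 h24 (qProd (-1)) * evenTheta Complex.I) * hkey

end

section

open PowerSeries

/-- The coefficients of the alternating sum `det (Θ₂, Θ_odd, Θ₀)` over the three arguments. -/
noncomputable def vandermondeSign (l m n : ℤ) : ℂ :=
  residueIndicator 4 2 l * (residueIndicator 2 1 m * residueIndicator 4 0 n -
    residueIndicator 4 0 m * residueIndicator 2 1 n) -
  residueIndicator 2 1 l * (residueIndicator 4 2 m * residueIndicator 4 0 n -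
    residueIndicator 4 0 m * residueIndicator 4 2 n) +
  residueIndicator 4 0 l * (residueIndicator 4 2 m * residueIndicator 2 1 n -
    residueIndicator 2 1 m * residueIndicator 4 2 n)

/-- Translating the indices by `2`, `-2`, `-2` interchanges two columns of the determinant. -/
theorem vandermondeSign_add_two (l m n : ℤ) :
    vandermondeSign (l + 2) (m - 2) (n - 2) = -vandermondeSign l m n := by
  have h1 : ∀ j : ℤ, residueIndicator 4 0 (j + 2) = residueIndicator 4 2 j := fun j => by
    simp only [residueIndicator]; split_ifs <;> first | omega | rfl
  have h2 : ∀ j : ℤ, residueIndicator 4 2 (j + 2) = residueIndicator 4 0 j := fun j => by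
    simp only [residueIndicator]; split_ifs <;> first | omega | rfl
  have h3 : ∀ j : ℤ, residueIndicator 2 1 (j + 2) = residueIndicator 2 1 j := fun j => by
    simp only [residueIndicator]; split_ifs <;> first | omega | rfl
  have h4 : ∀ j : ℤ, residueIndicator 4 0 (j - 2) = residueIndicator 4 2 j := fun j => by
    simp only [residueIndicator]; split_ifs <;> first | omega | rfl
  have h5 : ∀ j : ℤ, residueIndicator 4 2 (j - 2) = residueIndicator 4 0 j := fun j => by
    simp only [residueIndicator]; split_ifs <;> first | omega | rfl
  have h6 : ∀ j : ℤ, residueIndicator 2 1 (j - 2) = residueIndicator 2 1 j := fun j => by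
    simp only [residueIndicator]; split_ifs <;> first | omega | rfl
  simp only [vandermondeSign, h1, h2, h3, h4, h5, h6]
  ring

theorem vandermondeSign_add_two_mul (l m n p : ℤ) :
    vandermondeSign (2 * p + l) (m - 2 * p) (n - 2 * p) = vandermondeSign l m n * (-1) ^ p := by
  induction p using Int.induction_on with
  | zero => simp
  | succ i ih =>
    rw [zpow_add_one₀ (by norm_num), ← mul_assoc, ← ih, mul_neg_one, ← vandermondeSign_add_two]
    congr 1 <;> ring
  | pred i ih =>
    rw [zpow_sub_one₀ (by norm_num), ← mul_assoc, ← ih, inv_neg, inv_one, mul_neg_one,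
      eq_neg_iff_add_eq_zero, ← neg_eq_iff_add_eq_zero, ← vandermondeSign_add_two]
    congr 1 <;> ring

theorem vandermondeSign_ne_zero {l m n : ℤ} (h : vandermondeSign l m n ≠ 0) :
    (l % 2 = 1 ∧ m % 2 = 0 ∧ n % 2 = 0) ∨ (l % 2 = 0 ∧ (m + n) % 2 = 1) := by
  by_contra h2
  apply h
  simp only [vandermondeSign, residueIndicator]
  rcases Int.emod_two_eq_zero_or_one l with h3 | h3 <;>
  rcases Int.emod_two_eq_zero_or_one m with h4 | h4 <;>
  rcases Int.emod_two_eq_zero_or_one n with h5 | h5 <;>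
  first
  | omega
  | (split_ifs <;> first | omega | norm_num)

/-- The alternating sum as a series over `ℤ³`. -/
theorem det_weightedTheta (a b c : ℂ) :
    quarterTheta 2 a * (halfTheta b * quarterTheta 0 c - quarterTheta 0 b * halfTheta c) -
    halfTheta a * (quarterTheta 2 b * quarterTheta 0 c - quarterTheta 0 b * quarterTheta 2 c) +
    quarterTheta 0 a * (quarterTheta 2 b * halfTheta c - halfTheta b * quarterTheta 2 c) =
    latticeSeries (fun q : (ℤ × ℤ) × ℤ =>
      vandermondeSign q.1.1 q.1.2 q.2 * (a ^ q.1.1 * b ^ q.1.2 * c ^ q.2))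
      fun q => 3 * q.1.1 ^ 2 + 3 * q.1.2 ^ 2 + 3 * q.2 ^ 2 := by
  have h3 : (0 : ℤ) < 3 := by norm_num
  simp only [mul_sub, ← mul_assoc]
  rw [weightedTheta_mul_mul h3, weightedTheta_mul_mul h3, weightedTheta_mul_mul h3,
    weightedTheta_mul_mul h3, weightedTheta_mul_mul h3, weightedTheta_mul_mul h3]
  simp only [latticeSeries_sub (admissible_sq_add_sq_add_sq h3 _)
    (admissible_sq_add_sq_add_sq h3 _), latticeSeries_add (admissible_sq_add_sq_add_sq h3 _)
    (admissible_sq_add_sq_add_sq h3 _)]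
  refine latticeSeries_congr (fun q => ?_) fun q _ => rfl
  simp only [vandermondeSign]
  ring

/-- The parity of the first index on the line of the lattice `ℤ³` over the point `(s, t)`. -/
def lineParity (s t : ℤ) : ℤ := if s % 2 = 1 ∧ t % 2 = 1 then 1 else 0

/-- The parameter `d` of the line of the lattice `ℤ³` over the point `(s, t)`. -/
def lineShift (s t : ℤ) : ℤ := (s + t + 1 - 3 * lineParity s t) / 2

/-- The coefficients of the denominator of type `G₂`. -/
noncomputable def signG₂ (s t : ℤ) : ℂ :=
  vandermondeSign (lineParity s t) (t - lineParity s t) (s - lineParity s t) *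
    lineSign (lineShift s t)

/-- Specialising the third argument of the alternating sum to the product of the other two amounts
to summing along the lines in the direction `(1, -1, -1)`. -/
theorem det_weightedTheta_mul {u v : ℂ} (hu : u ≠ 0) (hv : v ≠ 0) :
    quarterTheta 2 (u * v) * (halfTheta v * quarterTheta 0 u - quarterTheta 0 v * halfTheta u) -
    halfTheta (u * v) *
      (quarterTheta 2 v * quarterTheta 0 u - quarterTheta 0 v * quarterTheta 2 u) +
    quarterTheta 0 (u * v) * (quarterTheta 2 v * halfTheta u - halfTheta v * quarterTheta 2 u) =
    etaSeries * latticeSeries (fun q : ℤ × ℤ => signG₂ q.1 q.2 * (u ^ q.1 * v ^ q.2))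
      fun q => 2 * (q.1 ^ 2 - q.1 * q.2 + q.2 ^ 2) := by
  have hp : ∀ s t, lineParity s t = 0 ∨ lineParity s t = 1 := fun s t => by
    unfold lineParity
    split_ifs <;> simp
  rw [det_weightedTheta, (latticeSeries_fibration
    (admissible_sq_add_sq_add_sq (by norm_num) _) (ι := ℤ × ℤ)
    (c := fun q => vandermondeSign (lineParity q.1 q.2) (q.2 - lineParity q.1 q.2)
      (q.1 - lineParity q.1 q.2) * (u ^ q.1 * v ^ q.2))
    (d := fun q => lineShift q.1 q.2)
    (g := fun q => 2 * (q.1 ^ 2 - q.1 * q.2 + q.2 ^ 2))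
    (fun q => ((2 * q.2 + lineParity q.1.1 q.1.2, q.1.2 - lineParity q.1.1 q.1.2 - 2 * q.2),
      q.1.1 - lineParity q.1.1 q.1.2 - 2 * q.2)) ?_ ?_ ?_ ?_ ?_).2]
  · congr 2
    ext q
    rw [signG₂]
    ring
  · rintro ⟨⟨s, t⟩, p⟩ ⟨⟨s', t'⟩, p'⟩ h
    simp only [Prod.mk.injEq] at h ⊢
    obtain ⟨⟨h1, h2⟩, h3⟩ := h
    obtain rfl : s = s' := by linarith
    obtain rfl : t = t' := by linarith
    refine ⟨⟨rfl, rfl⟩, ?_⟩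
    linarith
  · rintro ⟨⟨l, m⟩, n⟩ h
    have h1 := vandermondeSign_ne_zero (left_ne_zero_of_mul h)
    simp only at h1
    have h2 : lineParity (n + l) (m + l) = l % 2 := by
      unfold lineParity
      split_ifs <;> omega
    refine ⟨((n + l, m + l), l / 2), ?_⟩
    simp only [Prod.mk.injEq, h2]
    omega
  · rintro ⟨⟨s, t⟩, p⟩
    dsimp only
    rw [vandermondeSign_add_two_mul]
    have e : ∀ o : ℤ, (u * v) ^ (2 * p + o) * v ^ (t - o - 2 * p) * u ^ (s - o - 2 * p) =
        u ^ s * v ^ t := fun o => by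
      rw [mul_zpow, zpow_sub₀ hv, zpow_sub₀ hv, zpow_sub₀ hu, zpow_sub₀ hu, zpow_add₀ hu,
        zpow_add₀ hv]
      field_simp
    rw [e]
    ring
  · rintro ⟨⟨s, t⟩, p⟩ h
    have h1 := vandermondeSign_ne_zero (left_ne_zero_of_mul h)
    dsimp only at h1 ⊢
    have h2 : 2 * lineShift s t = s + t + 1 - 3 * lineParity s t := by
      unfold lineShift
      have : lineParity s t = if s % 2 = 1 ∧ t % 2 = 1 then 1 else 0 := rfl
      split_ifs at this <;> omega
    rw [h2]
    ring
  · rintro ⟨s, t⟩ -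
    nlinarith [sq_nonneg (s - t), sq_nonneg s, sq_nonneg t]

/-- The denominator identity of type `G₂`. The product is a Vandermonde product of the even and odd
parts of theta functions at the arguments `u`, `v` and `u v`. -/
theorem theta_mul_G₂ {u v : ℂ} (hu : u ≠ 0) (hv : v ≠ 0) :
    thetaSeries u * thetaSeries v * thetaSeries (u * v) * thetaSeries (v / u) *
      thetaSeries (u ^ 2 * v) * thetaSeries (u * v ^ 2) =
    etaSeries ^ 4 * (C (u ^ 2 * v ^ 3) *
      latticeSeries (fun q : ℤ × ℤ => signG₂ q.1 q.2 * (u ^ q.1 * v ^ q.2))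
        fun q => 2 * (q.1 ^ 2 - q.1 * q.2 + q.2 ^ 2)) := by
  have huv := mul_ne_zero hu hv
  have h1 := theta_mul_theta huv hv
  have h2 := theta_mul_theta huv hu
  have h3 := theta_mul_theta hv hu
  rw [mul_div_cancel_right₀ _ hv, show u * v * v = u * v ^ 2 by ring] at h1
  rw [mul_div_cancel_left₀ _ hu, show u * v * u = u ^ 2 * v by ring] at h2
  rw [mul_comm v u] at h3
  have hdet := det_weightedTheta_mul hu hv
  have hK : halfTheta 1 * (quarterTheta 0 1 ^ 2 - quarterTheta 2 1 ^ 2) = 2 * etaSeries ^ 3 := by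
    rw [halfTheta_one, ← evenTheta_I_sq, thetaSeries_neg_one_mul_evenTheta_I_sq]
  have h20 : (2 : PowerSeries ℂ) ≠ 0 := fun h => by
    have := congrArg constantCoeff h
    rw [map_ofNat, map_zero] at this
    exact two_ne_zero this
  have hC : (C (u ^ 2 * v ^ 3) : PowerSeries ℂ) = C (u * v) * C (u * v) * C v := by
    rw [← map_mul, ← map_mul]
    congr 1
    ring
  apply mul_left_cancel₀ h20
  calc 2 * (thetaSeries u * thetaSeries v * thetaSeries (u * v) * thetaSeries (v / u) *
      thetaSeries (u ^ 2 * v) * thetaSeries (u * v ^ 2))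
      = 2 * ((thetaSeries (u * v ^ 2) * thetaSeries u) * (thetaSeries (u ^ 2 * v) *
        thetaSeries v) * (thetaSeries (u * v) * thetaSeries (v / u))) := by ring
    _ = C (u ^ 2 * v ^ 3) *
        ((oddTheta (u * v) * oddTheta (u * v)) *
          ((2 * (evenTheta v * oddTheta v)) * (evenTheta u * evenTheta u) -
            (evenTheta v * evenTheta v) * (2 * (evenTheta u * oddTheta u))) -
        (2 * (evenTheta (u * v) * oddTheta (u * v))) *
          ((oddTheta v * oddTheta v) * (evenTheta u * evenTheta u) -
            (evenTheta v * evenTheta v) * (oddTheta u * oddTheta u)) +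
        (evenTheta (u * v) * evenTheta (u * v)) *
          ((oddTheta v * oddTheta v) * (2 * (evenTheta u * oddTheta u)) -
            (2 * (evenTheta v * oddTheta v)) * (oddTheta u * oddTheta u))) := by
      rw [h1, h2, h3, hC]
      ring
    _ = C (u ^ 2 * v ^ 3) * ((halfTheta 1 * (quarterTheta 0 1 ^ 2 - quarterTheta 2 1 ^ 2)) *
        (quarterTheta 2 (u * v) * (halfTheta v * quarterTheta 0 u -
          quarterTheta 0 v * halfTheta u) - halfTheta (u * v) *
          (quarterTheta 2 v * quarterTheta 0 u - quarterTheta 0 v * quarterTheta 2 u) +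
        quarterTheta 0 (u * v) * (quarterTheta 2 v * halfTheta u -
          halfTheta v * quarterTheta 2 u))) := by
      simp only [evenTheta_sq hu, evenTheta_sq hv, evenTheta_sq huv, oddTheta_sq hu,
        oddTheta_sq hv, oddTheta_sq huv, two_mul_evenTheta_mul_oddTheta hu,
        two_mul_evenTheta_mul_oddTheta hv, two_mul_evenTheta_mul_oddTheta huv]
      ring
    _ = _ := by
      rw [hdet, hK]
      ring

end

/-! ### Vanishing coefficients -/

section

open PowerSeries

theorem dvd_of_dvd_sq_add_three_mul_sq {ℓ : ℕ} (hℓ : ℓ.Prime) (h5 : 5 ≤ ℓ) (h3 : ℓ ≡ 2 [MOD 3])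
    {a b : ℤ} (h : (ℓ : ℤ) ∣ a ^ 2 + 3 * b ^ 2) : (ℓ : ℤ) ∣ a ∧ (ℓ : ℤ) ∣ b := by
  have := Fact.mk hℓ
  have h3' : ℓ % 3 = 2 := h3
  simp only [← ZMod.intCast_zmod_eq_zero_iff_dvd] at h ⊢
  push_cast at h
  have n2 : (2 : ZMod ℓ) ≠ 0 := by
    intro h0
    have : ((2 : ℕ) : ZMod ℓ) = 0 := by exact_mod_cast h0
    rw [ZMod.natCast_eq_zero_iff] at this
    have := Nat.le_of_dvd (by norm_num) this
    omega
  have n3 : (3 : ZMod ℓ) ≠ 0 := by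
    intro h0
    have : ((3 : ℕ) : ZMod ℓ) = 0 := by exact_mod_cast h0
    rw [ZMod.natCast_eq_zero_iff] at this
    have := Nat.le_of_dvd (by norm_num) this
    omega
  by_cases hb : (b : ZMod ℓ) = 0
  · rw [hb] at h
    simp only [ne_eq, OfNat.ofNat_ne_zero, not_false_eq_true, zero_pow, mul_zero, add_zero,
      pow_eq_zero_iff] at h
    exact ⟨h, hb⟩
  · exfalso
    -- `-3` is a square, so there is a primitive cube root of unity
    obtain ⟨w, hw⟩ : ∃ w : ZMod ℓ, w ^ 2 + w + 1 = 0 := by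
      refine ⟨((a : ZMod ℓ) / b - 1) / 2, ?_⟩
      field_simp
      linear_combination h
    have hw3 : w ^ 3 = 1 := by linear_combination (w - 1) * hw
    have hw1 : w ≠ 1 := by
      rintro rfl
      apply n3
      linear_combination hw
    have hw0 : w ≠ 0 := by
      rintro rfl
      simp at hw
    have : Fact (Nat.Prime 3) := ⟨Nat.prime_three⟩
    have h1 := orderOf_eq_prime hw3 hw1
    have h2 := ZMod.orderOf_dvd_card_sub_one hw0
    rw [h1] at h2
    omega

theorem dvd_of_dvd_sq_add_sq {ℓ : ℕ} (hℓ : ℓ.Prime) (h4 : ℓ ≡ 3 [MOD 4])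
    {a b : ℤ} (h : (ℓ : ℤ) ∣ a ^ 2 + b ^ 2) : (ℓ : ℤ) ∣ a ∧ (ℓ : ℤ) ∣ b := by
  have := Fact.mk hℓ
  simp only [← ZMod.intCast_zmod_eq_zero_iff_dvd] at h ⊢
  push_cast at h
  by_cases hb : (b : ZMod ℓ) = 0
  · rw [hb] at h
    simp only [ne_eq, OfNat.ofNat_ne_zero, not_false_eq_true, zero_pow, add_zero,
      pow_eq_zero_iff] at h
    exact ⟨h, hb⟩
  · exact absurd h4 (ZMod.mod_four_ne_three_of_sq_eq_neg_sq' hb (eq_neg_of_add_eq_zero_left h))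

theorem zpow_eq_zpow_of_dvd {x : ℂ} {ℓ : ℕ} (hx0 : x ≠ 0) (hx : x ^ ℓ = 1) {m n : ℤ}
    (h : (ℓ : ℤ) ∣ m - n) : x ^ m = x ^ n := by
  obtain ⟨k, hk⟩ := h
  rw [show m = n + ℓ * k by linarith, zpow_add₀ hx0, zpow_mul, zpow_natCast, hx, one_zpow, mul_one]

/-- If the monomials `m i` agree on all the terms that contribute to the `N`-th coefficient, and
if this coefficient vanishes without the monomials, then it vanishes with them. -/
theorem coeff_latticeSeries_eq_zero {ι : Type*} {w m : ι → ℂ} {e : ι → ℤ} {N : ℕ}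
    (hm : ∀ i j, e i = N → e j = N → m i = m j) (h : coeff N (latticeSeries w e) = 0) :
    coeff N (latticeSeries (fun i => w i * m i) e) = 0 := by
  rw [latticeSeries, coeff_mk] at h ⊢
  by_cases hi : ∃ i, e i = N
  · obtain ⟨i, hi⟩ := hi
    have : ∀ j, (if e j = (N : ℤ) then w j * m j else 0) =
        m i • (if e j = (N : ℤ) then w j else 0) := fun j => by
      split_ifs with hj
      · rw [hm i j hi hj, smul_eq_mul, mul_comm]
      · simp
    rw [finsum_congr this, ← smul_finsum, h, smul_zero]
  · push Not at hi
    exact finsum_eq_zero_of_forall_eq_zero fun j => if_neg (hi j)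

/-- The product `∏ (1 - x q^n) (1 - x⁻¹ q^n)`. -/
noncomputable def symProd (x : ℂ) : PowerSeries ℂ := qProd x * qProd x⁻¹

theorem thetaSeries_eq {x : ℂ} (hx : x ≠ 0) : thetaSeries x = C (1 - x) * X ^ 3 *
    expand 24 (by norm_num) (qProd 1 * symProd x) := by
  rw [thetaSeries_eq_prod hx, symProd, mul_assoc (qProd 1)]

/-- Passage from the coefficients of a series in `Q` to those of a product in `q = Q^24`. -/
theorem coeff_eq_zero_of_etaSeries_mul {P S F : PowerSeries ℂ} {k h N : ℕ} {c : ℂ} (hc : c ≠ 0)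
    (h1 : P = etaSeries ^ k * S)
    (h2 : P = C c * X ^ (h + k) * expand 24 (by norm_num) (qProd 1 ^ k * F))
    (h3 : coeff (24 * N + h) S = 0) : coeff N F = 0 := by
  have h4 : S = C c * X ^ h * expand 24 (by norm_num) F := by
    apply mul_left_cancel₀ (pow_ne_zero k etaSeries_ne_zero)
    rw [← h1, h2, etaSeries_eq_prod, map_mul, map_pow]
    ring
  rw [h4, mul_assoc, coeff_C_mul, coeff_X_pow_mul, coeff_expand_mul] at h3
  exact (mul_eq_zero.mp h3).resolve_left hc

variable {ℓ : ℕ} {x y : ℂ}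

theorem ne_zero_of_pow_eq_one {x : ℂ} {ℓ : ℕ} (hℓ : ℓ.Prime) (hx : x ^ ℓ = 1) : x ≠ 0 := by
  rintro rfl
  rw [zero_pow hℓ.ne_zero] at hx
  exact zero_ne_one hx

theorem etaSeries_mul_thetaSeries (x : ℂ) : etaSeries * thetaSeries x =
    latticeSeries (fun q : ℤ × ℤ => ((-1) ^ q.1 * (-1) ^ q.2) * x ^ q.2)
      fun q => (6 * q.1 + 1) ^ 2 + 3 * (2 * q.2 - 1) ^ 2 := by
  rw [etaSeries, thetaSeries, latticeSeries_mul admissible_eta (admissible_theta x)]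
  simp only [mul_assoc]

theorem thetaSeries_mul_thetaSeries (x y : ℂ) : thetaSeries x * thetaSeries y =
    latticeSeries (fun q : ℤ × ℤ => ((-1) ^ q.1 * (-1) ^ q.2) * (x ^ q.1 * y ^ q.2))
      fun q => 3 * (2 * q.1 - 1) ^ 2 + 3 * (2 * q.2 - 1) ^ 2 := by
  rw [thetaSeries, thetaSeries, latticeSeries_mul (admissible_theta x) (admissible_theta y)]
  congr 1
  ext q
  ring

theorem dvd_sub_of_dvd_odd (hℓ : ℓ.Prime) (h5 : 5 ≤ ℓ) {m n r : ℤ} (hm : (ℓ : ℤ) ∣ 2 * m - r)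
    (hn : (ℓ : ℤ) ∣ 2 * n - r) : (ℓ : ℤ) ∣ m - n := by
  have h1 : (ℓ : ℤ) ∣ 2 * (m - n) := by
    have := dvd_sub hm hn
    rwa [show 2 * m - r - (2 * n - r) = 2 * (m - n) by ring] at this
  have h2 : IsCoprime (ℓ : ℤ) 2 := by
    rw [Int.isCoprime_iff_gcd_eq_one]
    exact (Nat.coprime_primes hℓ Nat.prime_two).mpr (by omega)
  exact h2.dvd_of_dvd_mul_left h1

theorem dvd_of_dvd_three_mul (hℓ : ℓ.Prime) (h5 : 5 ≤ ℓ) {a : ℤ} (h : (ℓ : ℤ) ∣ 3 * a) :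
    (ℓ : ℤ) ∣ a := by
  have h2 : IsCoprime (ℓ : ℤ) 3 := by
    rw [Int.isCoprime_iff_gcd_eq_one]
    exact (Nat.coprime_primes hℓ Nat.prime_three).mpr (by omega)
  exact h2.dvd_of_dvd_mul_left h

/-- The norm form of the Eisenstein integers is anisotropic modulo `ℓ ≡ 2 (mod 3)`. -/
theorem dvd_of_dvd_eisenstein (hℓ : ℓ.Prime) (h5 : 5 ≤ ℓ) (h3 : ℓ ≡ 2 [MOD 3]) {a b : ℤ}
    (h : (ℓ : ℤ) ∣ 2 * (a ^ 2 - a * b + b ^ 2)) : (ℓ : ℤ) ∣ a ∧ (ℓ : ℤ) ∣ b := by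
  have h1 : (ℓ : ℤ) ∣ (2 * a - b) ^ 2 + 3 * b ^ 2 := by
    obtain ⟨k, hk⟩ := h
    exact ⟨2 * k, by linear_combination 2 * hk⟩
  obtain ⟨h2, h4⟩ := dvd_of_dvd_sq_add_three_mul_sq hℓ h5 h3 h1
  refine ⟨?_, h4⟩
  have := dvd_sub_of_dvd_odd hℓ h5 (m := a) (n := 0) (r := b) h2 (by simpa using h4)
  simpa using this

theorem coeff_block_four (hℓ : ℓ.Prime) (h5 : 5 ≤ ℓ) (h3 : ℓ ≡ 2 [MOD 3]) (hx : x ^ ℓ = 1)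
    (hx1 : x ≠ 1) {N : ℕ} (hN : ℓ ∣ 24 * N + 4) : coeff N (qProd 1 ^ 2 * symProd x) = 0 := by
  have hx0 := ne_zero_of_pow_eq_one hℓ hx
  refine coeff_eq_zero_of_etaSeries_mul (k := 0) (h := 4) (c := 1 - x)
    (P := etaSeries * thetaSeries x) (S := etaSeries * thetaSeries x)
    (sub_ne_zero.mpr hx1.symm) (by simp) ?_ ?_
  · rw [etaSeries_eq_prod, thetaSeries_eq hx0]
    simp only [map_mul, map_pow]
    ring
  · rw [etaSeries_mul_thetaSeries]
    refine coeff_latticeSeries_eq_zero (fun i j hi hj => ?_) ?_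
    · apply zpow_eq_zpow_of_dvd hx0 hx
      have key : ∀ q : ℤ × ℤ,
          (6 * q.1 + 1) ^ 2 + 3 * (2 * q.2 - 1) ^ 2 = ((24 * N + 4 : ℕ) : ℤ) →
          (ℓ : ℤ) ∣ 2 * q.2 - 1 := fun q hq =>
        (dvd_of_dvd_sq_add_three_mul_sq hℓ h5 h3
          (hq ▸ Int.natCast_dvd_natCast.mpr hN)).2
      exact dvd_sub_of_dvd_odd hℓ h5 (key i hi) (key j hj)
    · have := etaSeries_mul_thetaSeries 1
      simp only [one_zpow, mul_one, thetaSeries_one, mul_zero] at this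
      rw [← this, map_zero]

theorem coeff_block_six (hℓ : ℓ.Prime) (h5 : 5 ≤ ℓ) (h4 : ℓ ≡ 3 [MOD 4]) (hx : x ^ ℓ = 1)
    (hy : y ^ ℓ = 1) (hx1 : x ≠ 1) (hy1 : y ≠ 1) {N : ℕ} (hN : ℓ ∣ 24 * N + 6) :
    coeff N (qProd 1 ^ 2 * (symProd x * symProd y)) = 0 := by
  have hx0 := ne_zero_of_pow_eq_one hℓ hx
  have hy0 := ne_zero_of_pow_eq_one hℓ hy
  refine coeff_eq_zero_of_etaSeries_mul (k := 0) (h := 6) (c := (1 - x) * (1 - y))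
    (P := thetaSeries x * thetaSeries y) (S := thetaSeries x * thetaSeries y)
    (mul_ne_zero (sub_ne_zero.mpr hx1.symm) (sub_ne_zero.mpr hy1.symm)) (by simp) ?_ ?_
  · rw [thetaSeries_eq hx0, thetaSeries_eq hy0]
    simp only [map_mul, map_pow]
    ring
  · rw [thetaSeries_mul_thetaSeries]
    refine coeff_latticeSeries_eq_zero (fun i j hi hj => ?_) ?_
    · have key : ∀ q : ℤ × ℤ,
          3 * (2 * q.1 - 1) ^ 2 + 3 * (2 * q.2 - 1) ^ 2 = ((24 * N + 6 : ℕ) : ℤ) →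
          (ℓ : ℤ) ∣ 2 * q.1 - 1 ∧ (ℓ : ℤ) ∣ 2 * q.2 - 1 := fun q hq => by
        apply dvd_of_dvd_sq_add_sq hℓ h4
        apply dvd_of_dvd_three_mul hℓ h5
        rw [mul_add, hq]
        exact Int.natCast_dvd_natCast.mpr hN
      rw [zpow_eq_zpow_of_dvd hx0 hx (dvd_sub_of_dvd_odd hℓ h5 (key i hi).1 (key j hj).1),
        zpow_eq_zpow_of_dvd hy0 hy (dvd_sub_of_dvd_odd hℓ h5 (key i hi).2 (key j hj).2)]
    · have := thetaSeries_mul_thetaSeries 1 1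
      simp only [one_zpow, mul_one, thetaSeries_one, mul_zero] at this
      rw [← this, map_zero]

theorem coeff_block_eight (hℓ : ℓ.Prime) (h5 : 5 ≤ ℓ) (h3 : ℓ ≡ 2 [MOD 3]) (hx : x ^ ℓ = 1)
    (hy : y ^ ℓ = 1) (hx1 : x ≠ 1) (hy1 : y ≠ 1) (hxy : x * y ≠ 1) {N : ℕ}
    (hN : ℓ ∣ 24 * N + 8) :
    coeff N (qProd 1 ^ 2 * (symProd x * symProd y * symProd (x * y))) = 0 := by
  have hx0 := ne_zero_of_pow_eq_one hℓ hx
  have hy0 := ne_zero_of_pow_eq_one hℓ hy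
  refine coeff_eq_zero_of_etaSeries_mul (k := 1) (h := 8)
    (c := (1 - x) * (1 - y) * (1 - x * y))
    (mul_ne_zero (mul_ne_zero (sub_ne_zero.mpr hx1.symm) (sub_ne_zero.mpr hy1.symm))
      (sub_ne_zero.mpr hxy.symm)) ((theta_mul_A₂ hx0 hy0).trans (by rw [pow_one])) ?_ ?_
  · rw [thetaSeries_eq hx0, thetaSeries_eq hy0, thetaSeries_eq (mul_ne_zero hx0 hy0)]
    simp only [map_mul, map_pow]
    ring
  · refine coeff_latticeSeries_eq_zero (fun i j hi hj => ?_) ?_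
    · have key : ∀ q : ℤ × ℤ,
          8 * (q.1 ^ 2 + q.2 ^ 2 - q.1 * q.2 - q.1 - q.2 + 1) = ((24 * N + 8 : ℕ) : ℤ) →
          (ℓ : ℤ) ∣ q.1 - 1 ∧ (ℓ : ℤ) ∣ q.2 - 1 := fun q hq => by
        have h1 : (ℓ : ℤ) ∣ 2 * ((2 * (q.1 - 1)) ^ 2 - (2 * (q.1 - 1)) * (2 * (q.2 - 1)) +
            (2 * (q.2 - 1)) ^ 2) := by
          rw [show 2 * ((2 * (q.1 - 1)) ^ 2 - (2 * (q.1 - 1)) * (2 * (q.2 - 1)) +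
            (2 * (q.2 - 1)) ^ 2) = 8 * (q.1 ^ 2 + q.2 ^ 2 - q.1 * q.2 - q.1 - q.2 + 1) by ring, hq]
          exact Int.natCast_dvd_natCast.mpr hN
        obtain ⟨h2, h4⟩ := dvd_of_dvd_eisenstein hℓ h5 h3 h1
        exact ⟨dvd_sub_of_dvd_odd hℓ h5 (r := 2) (by rwa [mul_sub] at h2) (by simp),
          dvd_sub_of_dvd_odd hℓ h5 (r := 2) (by rwa [mul_sub] at h4) (by simp)⟩
      have e : ∀ m n : ℤ, (ℓ : ℤ) ∣ m - 1 → (ℓ : ℤ) ∣ n - 1 → (ℓ : ℤ) ∣ m - n := fun m n hm hn => by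
        simpa using dvd_sub hm hn
      rw [zpow_eq_zpow_of_dvd hx0 hx (e _ _ (key i hi).1 (key j hj).1),
        zpow_eq_zpow_of_dvd hy0 hy (e _ _ (key i hi).2 (key j hj).2)]
    · have := theta_mul_A₂ one_ne_zero one_ne_zero
      simp only [one_zpow, mul_one, thetaSeries_one, mul_zero] at this
      rw [(mul_eq_zero.mp this.symm).resolve_left etaSeries_ne_zero, map_zero]

theorem coeff_block_ten (hℓ : ℓ.Prime) (h5 : 5 ≤ ℓ) (h4 : ℓ ≡ 3 [MOD 4]) (hx : x ^ ℓ = 1)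
    (hy : y ^ ℓ = 1) (hx1 : x ≠ 1) (hy1 : y ≠ 1) (hxy : x * y ≠ 1) (hxy' : x / y ≠ 1) {N : ℕ}
    (hN : ℓ ∣ 24 * N + 10) :
    coeff N (qProd 1 ^ 2 * (symProd x * symProd y * symProd (x * y) * symProd (x / y))) = 0 := by
  have hx0 := ne_zero_of_pow_eq_one hℓ hx
  have hy0 := ne_zero_of_pow_eq_one hℓ hy
  refine coeff_eq_zero_of_etaSeries_mul (k := 2) (h := 10)
    (c := (1 - x) * (1 - y) * (1 - x * y) * (1 - x / y))
    (mul_ne_zero (mul_ne_zero (mul_ne_zero (sub_ne_zero.mpr hx1.symm) (sub_ne_zero.mpr hy1.symm))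
      (sub_ne_zero.mpr hxy.symm)) (sub_ne_zero.mpr hxy'.symm)) (theta_mul_B₂ hx0 hy0) ?_ ?_
  · rw [thetaSeries_eq hx0, thetaSeries_eq hy0, thetaSeries_eq (mul_ne_zero hx0 hy0),
      thetaSeries_eq (div_ne_zero hx0 hy0)]
    simp only [map_mul, map_pow]
    ring
  · refine coeff_latticeSeries_eq_zero (fun i j hi hj => ?_) ?_
    · have key : ∀ q : ℤ × ℤ,
          (2 * q.1 - 3) ^ 2 + (2 * q.2 - 1) ^ 2 = ((24 * N + 10 : ℕ) : ℤ) →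
          (ℓ : ℤ) ∣ 2 * q.1 - 3 ∧ (ℓ : ℤ) ∣ 2 * q.2 - 1 := fun q hq => by
        apply dvd_of_dvd_sq_add_sq hℓ h4
        rw [hq]
        exact Int.natCast_dvd_natCast.mpr hN
      rw [zpow_eq_zpow_of_dvd hx0 hx (dvd_sub_of_dvd_odd hℓ h5 (key i hi).1 (key j hj).1),
        zpow_eq_zpow_of_dvd hy0 hy (dvd_sub_of_dvd_odd hℓ h5 (key i hi).2 (key j hj).2)]
    · have := theta_mul_B₂ one_ne_zero one_ne_zero
      simp only [one_zpow, mul_one, thetaSeries_one, zero_mul] at this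
      rw [(mul_eq_zero.mp this.symm).resolve_left (pow_ne_zero _ etaSeries_ne_zero), map_zero]

theorem coeff_block_fourteen (hℓ : ℓ.Prime) (h5 : 5 ≤ ℓ) (h3 : ℓ ≡ 2 [MOD 3]) (hx : x ^ ℓ = 1)
    (hy : y ^ ℓ = 1) (hx1 : x ≠ 1) (hy1 : y ≠ 1) (hxy : x * y ≠ 1) (hyx : y / x ≠ 1)
    (hxxy : x ^ 2 * y ≠ 1) (hxyy : x * y ^ 2 ≠ 1) {N : ℕ} (hN : ℓ ∣ 24 * N + 14) :
    coeff N (qProd 1 ^ 2 * (symProd x * symProd y * symProd (x * y) * symProd (y / x) *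
      symProd (x ^ 2 * y) * symProd (x * y ^ 2))) = 0 := by
  have hx0 := ne_zero_of_pow_eq_one hℓ hx
  have hy0 := ne_zero_of_pow_eq_one hℓ hy
  refine coeff_eq_zero_of_etaSeries_mul (k := 4) (h := 14)
    (c := (1 - x) * (1 - y) * (1 - x * y) * (1 - y / x) * (1 - x ^ 2 * y) * (1 - x * y ^ 2))
    (mul_ne_zero (mul_ne_zero (mul_ne_zero (mul_ne_zero (mul_ne_zero (sub_ne_zero.mpr hx1.symm)
      (sub_ne_zero.mpr hy1.symm)) (sub_ne_zero.mpr hxy.symm)) (sub_ne_zero.mpr hyx.symm))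
      (sub_ne_zero.mpr hxxy.symm)) (sub_ne_zero.mpr hxyy.symm)) (theta_mul_G₂ hx0 hy0) ?_ ?_
  · rw [thetaSeries_eq hx0, thetaSeries_eq hy0, thetaSeries_eq (mul_ne_zero hx0 hy0),
      thetaSeries_eq (div_ne_zero hy0 hx0), thetaSeries_eq (mul_ne_zero (pow_ne_zero 2 hx0) hy0),
      thetaSeries_eq (mul_ne_zero hx0 (pow_ne_zero 2 hy0))]
    simp only [map_mul, map_pow]
    ring
  · rw [coeff_C_mul]
    refine mul_eq_zero_of_right _ (coeff_latticeSeries_eq_zero (fun i j hi hj => ?_) ?_)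
    · have key : ∀ q : ℤ × ℤ,
          2 * (q.1 ^ 2 - q.1 * q.2 + q.2 ^ 2) = ((24 * N + 14 : ℕ) : ℤ) →
          (ℓ : ℤ) ∣ q.1 ∧ (ℓ : ℤ) ∣ q.2 := fun q hq => by
        apply dvd_of_dvd_eisenstein hℓ h5 h3
        rw [hq]
        exact Int.natCast_dvd_natCast.mpr hN
      rw [zpow_eq_zpow_of_dvd hx0 hx (dvd_sub (key i hi).1 (key j hj).1),
        zpow_eq_zpow_of_dvd hy0 hy (dvd_sub (key i hi).2 (key j hj).2)]
    · have := theta_mul_G₂ one_ne_zero one_ne_zero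
      simp only [one_zpow, one_pow, mul_one, thetaSeries_one, zero_mul, map_one, one_mul] at this
      rw [(mul_eq_zero.mp this.symm).resolve_left (pow_ne_zero _ etaSeries_ne_zero), map_zero]

end

/-! ### Evaluation of the crank generating function at a root of unity -/

section

open PowerSeries

/-- Evaluation of Laurent polynomials at the unit `u`. -/
noncomputable def evalLaurent (u : ℂˣ) : LaurentPolynomial ℤ →+* ℂ :=
  LaurentPolynomial.eval₂ (Int.castRingHom ℂ) u

theorem evalLaurent_T (u : ℂˣ) (a : ℤ) : evalLaurent u (LaurentPolynomial.T a) = (u : ℂ) ^ a := by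
  rw [evalLaurent, LaurentPolynomial.eval₂_T, Units.val_zpow_eq_zpow_val]

theorem cyclotomic_dvd_of_evalLaurent_eq_zero {ℓ : ℕ} (hℓ : 0 < ℓ) {u : ℂˣ}
    (hu : IsPrimitiveRoot (u : ℂ) ℓ) {f : LaurentPolynomial ℤ} (hf : evalLaurent u f = 0) :
    Polynomial.toLaurent (Polynomial.cyclotomic ℓ ℤ) ∣ f := by
  obtain ⟨n, g, hg⟩ := f.exists_T_pow
  have h1 : Polynomial.aeval (u : ℂ) g = 0 := by
    have := congrArg (evalLaurent u) hg
    rw [map_mul, hf, zero_mul, evalLaurent, LaurentPolynomial.eval₂_toLaurent] at this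
    rw [Polynomial.aeval_def]
    exact this
  have h2 : Polynomial.cyclotomic ℓ ℤ ∣ g := by
    rw [Polynomial.cyclotomic_eq_minpoly hu hℓ]
    exact minpoly.isIntegrallyClosed_dvd (hu.isIntegral hℓ) h1
  have h3 : f = Polynomial.toLaurent g * LaurentPolynomial.T (-n) := by
    rw [hg, mul_assoc, ← LaurentPolynomial.T_add, add_neg_cancel, LaurentPolynomial.T_zero,
      mul_one]
  rw [h3]
  exact Dvd.dvd.mul_right (map_dvd _ h2) _

theorem hasTruncations_crankGF (a : ℤ) :
    HasTruncations (fun M => ∏ n ∈ Finset.Icc 1 M, crankFactor a n) (crankGF a) :=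
  fun _ _ h => coeff_crankGF a h

variable {ζ : ℂˣ}

theorem map_crankGF_mul (a : ℤ) :
    PowerSeries.map (evalLaurent ζ) (crankGF a) * symProd ((ζ : ℂ) ^ a) = qProd 1 := by
  refine (((hasTruncations_crankGF a).map (evalLaurent ζ)).mul
    ((hasTruncations_qProd _).mul (hasTruncations_qProd _))).unique ?_
  convert hasTruncations_qProd (1 : ℂ) using 2 with M
  rw [map_prod, ← Finset.prod_mul_distrib, ← Finset.prod_mul_distrib]
  refine Finset.prod_congr rfl fun n hn => ?_
  have h := congrArg (PowerSeries.map (evalLaurent ζ))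
    (crankFactor_mul a (n := n) (Finset.mem_Icc.mp hn).1)
  simp only [map_mul, map_sub, map_one, map_pow, map_X, map_C, evalLaurent_T, zpow_neg] at h
  rw [h, map_one, one_mul]

theorem symProd_ne_zero (x : ℂ) : symProd x ≠ 0 := mul_ne_zero (qProd_ne_zero _) (qProd_ne_zero _)

theorem symProd_inv (x : ℂ) : symProd x⁻¹ = symProd x := by
  rw [symProd, symProd, inv_inv, mul_comm]

theorem even_sub_deltaOdd (k : ℕ) : deltaOdd k ≤ k ∧ Even (k - deltaOdd k) := by
  unfold deltaOdd
  split_ifs with h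
  · obtain ⟨m, rfl⟩ := h
    exact ⟨by omega, ⟨m, by omega⟩⟩
  · rw [Nat.not_odd_iff_even] at h
    simpa using h

theorem map_coloredCrankGF_mul (k : ℕ) (a : Fin ((k + deltaOdd k) / 2) → ℤ) :
    PowerSeries.map (evalLaurent ζ) (coloredCrankGF k a) * ∏ i, symProd ((ζ : ℂ) ^ a i) =
      qProd 1 ^ deltaOdd k := by
  have h0 : PowerSeries.map (evalLaurent ζ) (crankGF 0) * qProd 1 = 1 := by
    apply mul_right_cancel₀ (qProd_ne_zero (1 : ℂ))
    have := map_crankGF_mul (ζ := ζ) 0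
    rw [zpow_zero, symProd, inv_one] at this
    rw [one_mul, mul_assoc, this]
  have hm : (k + deltaOdd k) / 2 = (k - deltaOdd k) / 2 + deltaOdd k := by
    obtain ⟨h1, m, h2⟩ := even_sub_deltaOdd k
    omega
  rw [coloredCrankGF, map_mul, map_pow, map_prod, mul_assoc, ← Finset.prod_mul_distrib,
    Finset.prod_congr rfl fun i _ => map_crankGF_mul (a i), Finset.prod_const, Finset.card_univ,
    Fintype.card_fin]
  conv_lhs => rw [hm]
  rw [pow_add, ← mul_assoc, ← mul_pow, h0, one_pow, one_mul]

/-- The unmodified weights `±k, ±(k - 2), …` are the numbers `-k, -k + 2, …, k`, up to the number `0`. -/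
theorem prod_qProd_weights (k : ℕ) :
    (∏ i ∈ Finset.range (k + 1), qProd ((ζ : ℂ) ^ (2 * (i : ℤ) - k))) * qProd 1 ^ deltaOdd k =
      (∏ i ∈ Finset.range ((k + deltaOdd k) / 2), symProd ((ζ : ℂ) ^ ((k : ℤ) - 2 * i))) *
        qProd 1 := by
  induction k using Nat.twoStepInduction with
  | zero => simp [deltaOdd]
  | one => simp [deltaOdd, Finset.prod_range_succ, symProd, -mul_eq_mul_right_iff]; ring
  | more k ih _ =>
    have hd : deltaOdd (k + 2) = deltaOdd k := by
      unfold deltaOdd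
      congr 1
      simp [Nat.odd_add_one]
    have hm : (k + 2 + deltaOdd k) / 2 = (k + deltaOdd k) / 2 + 1 := by omega
    rw [hd, hm, Finset.prod_range_succ, Finset.prod_range_succ' _ (k + 1),
      Finset.prod_range_succ' _ ((k + deltaOdd k) / 2)]
    have e1 : ∀ i : ℕ, (2 * ((i + 1 : ℕ) : ℤ) - ((k + 2 : ℕ) : ℤ)) = 2 * (i : ℤ) - k := fun i => by
      push_cast; ring
    have e2 : ∀ i : ℕ, (((k + 2 : ℕ) : ℤ) - 2 * ((i + 1 : ℕ) : ℤ)) = (k : ℤ) - 2 * i := fun i => by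
      push_cast; ring
    have e3 : 2 * ((k + 1 : ℕ) : ℤ) - (k : ℤ) = ((k + 2 : ℕ) : ℤ) := by
      push_cast; ring
    have e4 : 2 * ((0 : ℕ) : ℤ) - ((k + 2 : ℕ) : ℤ) = -((k + 2 : ℕ) : ℤ) := by
      push_cast; ring
    have e5 : ((k + 2 : ℕ) : ℤ) - 2 * ((0 : ℕ) : ℤ) = ((k + 2 : ℕ) : ℤ) := by
      push_cast; ring
    simp only [e1, e2]
    rw [e3, e4, e5, symProd, zpow_neg]
    linear_combination (qProd ((ζ : ℂ) ^ ((k + 2 : ℕ) : ℤ)) *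
      qProd ((ζ : ℂ) ^ ((k + 2 : ℕ) : ℤ))⁻¹) * ih

variable {ℓ : ℕ}

/-- The product over a complete residue system, here run through in steps of `2`, is a power series
in `q ^ ℓ`. -/
theorem prod_qProd_residues (hℓ : ℓ.Prime) (h5 : 5 ≤ ℓ) (hζ : IsPrimitiveRoot (ζ : ℂ) ℓ) (c : ℤ) :
    ∏ i ∈ Finset.range ℓ, qProd ((ζ : ℂ) ^ (2 * (i : ℤ) + c)) =
      expand ℓ hℓ.ne_zero (qProd 1) := by
  have hζ0 : (ζ : ℂ) ≠ 0 := ζ.ne_zero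
  have : NeZero ℓ := ⟨hℓ.ne_zero⟩
  refine prod_qProd_eq_expand _ _ _ _ _ fun y => ?_
  have hη : IsPrimitiveRoot (C ((ζ : ℂ) ^ 2) : PowerSeries ℂ) ℓ :=
    (hζ.pow_of_coprime 2 ((Nat.coprime_primes Nat.prime_two hℓ).mpr (by omega))).map_of_injective
      (f := (C : ℂ →+* PowerSeries ℂ)) C_injective
  have hc : (C ((ζ : ℂ) ^ c) * y) ^ ℓ = y ^ ℓ := by
    rw [mul_pow, ← map_pow, ← zpow_natCast, ← zpow_mul, mul_comm c, zpow_mul, zpow_natCast,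
      hζ.pow_eq_one, one_zpow, map_one, one_mul]
  have h1 := hη.pow_sub_pow_eq_prod_sub_mul 1 (C ((ζ : ℂ) ^ c) * y) hℓ.pos
  rw [one_pow, hc] at h1
  rw [map_one, one_mul, h1]
  refine Finset.prod_bij (fun i _ => C ((ζ : ℂ) ^ 2) ^ i) (fun i _ => ?_) (fun i hi j hj hij => ?_)
    (fun x hx => ?_) (fun i _ => ?_)
  · rw [Polynomial.mem_nthRootsFinset hℓ.pos, ← pow_mul, mul_comm, pow_mul, hη.pow_eq_one, one_pow]
  · exact hη.pow_inj (Finset.mem_range.mp hi) (Finset.mem_range.mp hj) hij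
  · rw [Polynomial.mem_nthRootsFinset hℓ.pos] at hx
    obtain ⟨i, hi, h⟩ := hη.eq_pow_of_pow_eq_one hx
    exact ⟨i, Finset.mem_range.mpr hi, h⟩
  · rw [← map_pow, ← mul_assoc, ← map_mul, zpow_add₀ hζ0, zpow_mul]
    norm_cast

theorem prod_qProd_range_mul (hℓ : ℓ.Prime) (h5 : 5 ≤ ℓ) (hζ : IsPrimitiveRoot (ζ : ℂ) ℓ) (c : ℤ)
    (t : ℕ) : ∏ i ∈ Finset.range (ℓ * t), qProd ((ζ : ℂ) ^ (2 * (i : ℤ) + c)) =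
      expand ℓ hℓ.ne_zero (qProd 1) ^ t := by
  induction t with
  | zero => simp
  | succ t ih =>
    rw [mul_add, mul_one, Finset.prod_range_add, ih, pow_succ,
      ← prod_qProd_residues hℓ h5 hζ (2 * (ℓ * t) + c)]
    congr 1
    refine Finset.prod_congr rfl fun i _ => ?_
    congr 2
    push_cast
    ring

/-- The numbers `-k, -k + 2, …, k` and the `h - 1` further terms of this arithmetic progression
form `t` complete residue systems. -/
theorem prod_weights_mul_missing (hℓ : ℓ.Prime) (h5 : 5 ≤ ℓ) (hζ : IsPrimitiveRoot (ζ : ℂ) ℓ)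
    {k h t : ℕ} (hh : 1 ≤ h) (hkh : k + h = ℓ * t) :
    (∏ i ∈ Finset.range ((k + deltaOdd k) / 2), symProd ((ζ : ℂ) ^ ((k : ℤ) - 2 * i))) *
      (qProd 1 * ∏ i ∈ Finset.range (h - 1), qProd ((ζ : ℂ) ^ (2 * (i : ℤ) + 2 - h))) =
      qProd 1 ^ deltaOdd k * expand ℓ hℓ.ne_zero (qProd 1) ^ t := by
  have h1 := prod_qProd_range_mul hℓ h5 hζ (-k) t
  rw [← hkh, show k + h = k + 1 + (h - 1) by omega, Finset.prod_range_add] at h1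
  have h2 : ∀ i ∈ Finset.range (h - 1), qProd ((ζ : ℂ) ^ (2 * ((k + 1 + i : ℕ) : ℤ) + -k)) =
      qProd ((ζ : ℂ) ^ (2 * (i : ℤ) + 2 - h)) := fun i _ => by
    congr 1
    refine zpow_eq_zpow_of_dvd ζ.ne_zero hζ.pow_eq_one ⟨t, ?_⟩
    have : (k : ℤ) + h = ℓ * t := by exact_mod_cast hkh
    push_cast
    linear_combination this
  rw [Finset.prod_congr rfl h2] at h1
  have h3 := prod_qProd_weights (ζ := ζ) k
  simp only [sub_eq_add_neg] at h3 h1 ⊢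
  linear_combination qProd 1 ^ deltaOdd k * h1 -
    (∏ i ∈ Finset.range (h - 1), qProd ((ζ : ℂ) ^ (2 * (i : ℤ) + 2 + -h))) * h3

open Classical in
/-- The effect of replacing the first weight `k` by `k + 2`. -/
theorem prod_symProd_crankWeight {k : ℕ} (hk : 1 ≤ k) :
    (∏ i, symProd ((ζ : ℂ) ^ crankWeight k i)) *
      (if HasOddPrimeFactorTwoModThree k then symProd ((ζ : ℂ) ^ (k : ℤ)) else 1) =
    (∏ i ∈ Finset.range ((k + deltaOdd k) / 2), symProd ((ζ : ℂ) ^ ((k : ℤ) - 2 * i))) *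
      (if HasOddPrimeFactorTwoModThree k then symProd ((ζ : ℂ) ^ ((k : ℤ) + 2)) else 1) := by
  have e : ∏ i, symProd ((ζ : ℂ) ^ crankWeight k i) =
      ∏ i ∈ Finset.range ((k + deltaOdd k) / 2), symProd ((ζ : ℂ) ^
        (if i = 0 ∧ HasOddPrimeFactorTwoModThree k then (k : ℤ) + 2 else (k : ℤ) - 2 * i)) :=
    Fin.prod_univ_eq_prod_range (fun i => symProd ((ζ : ℂ) ^
        (if i = 0 ∧ HasOddPrimeFactorTwoModThree k then (k : ℤ) + 2 else (k : ℤ) - 2 * i))) _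
  obtain ⟨m, hm⟩ : ∃ m, (k + deltaOdd k) / 2 = m + 1 := by
    obtain ⟨h1, m, h2⟩ := even_sub_deltaOdd k
    exact ⟨(k + deltaOdd k) / 2 - 1, by omega⟩
  rw [e, hm, Finset.prod_range_succ', Finset.prod_range_succ']
  by_cases h : HasOddPrimeFactorTwoModThree k
  · simp only [Nat.add_eq_zero_iff, one_ne_zero, and_false, false_and, if_false, h, and_self,
      if_true, Nat.cast_zero, mul_zero, sub_zero]
    ring
  · simp only [h, and_false, if_false]

open Classical in
/-- Up to a power series in `q ^ ℓ`, the crank generating function at a root of unity of order `ℓ`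
is a product over the residues that are missing among the weights. -/
theorem map_kColoredCrankGF_mul (hℓ : ℓ.Prime) (h5 : 5 ≤ ℓ) (hζ : IsPrimitiveRoot (ζ : ℂ) ℓ)
    {k h t : ℕ} (hk : 1 ≤ k) (hh : 1 ≤ h) (hkh : k + h = ℓ * t) :
    PowerSeries.map (evalLaurent ζ) (kColoredCrankGF k) * expand ℓ hℓ.ne_zero (qProd 1 ^ t) *
      (if HasOddPrimeFactorTwoModThree k then symProd ((ζ : ℂ) ^ ((h : ℤ) - 2)) else 1) =
    (qProd 1 * ∏ i ∈ Finset.range (h - 1), qProd ((ζ : ℂ) ^ (2 * (i : ℤ) + 2 - h))) *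
      (if HasOddPrimeFactorTwoModThree k then symProd ((ζ : ℂ) ^ (h : ℤ)) else 1) := by
  have h1 := map_coloredCrankGF_mul (ζ := ζ) k (crankWeight k)
  have h2 := prod_symProd_crankWeight (ζ := ζ) hk
  have h3 := prod_weights_mul_missing hℓ h5 hζ hh hkh
  have hkh' : (k : ℤ) + h = ℓ * t := by exact_mod_cast hkh
  have e1 : symProd ((ζ : ℂ) ^ (k : ℤ)) = symProd ((ζ : ℂ) ^ (h : ℤ)) := by
    rw [← symProd_inv, ← zpow_neg]
    congr 1
    exact zpow_eq_zpow_of_dvd ζ.ne_zero hζ.pow_eq_one ⟨-t, by linear_combination -hkh'⟩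
  have e2 : symProd ((ζ : ℂ) ^ ((k : ℤ) + 2)) = symProd ((ζ : ℂ) ^ ((h : ℤ) - 2)) := by
    rw [← symProd_inv, ← zpow_neg]
    congr 1
    exact zpow_eq_zpow_of_dvd ζ.ne_zero hζ.pow_eq_one ⟨-t, by linear_combination -hkh'⟩
  rw [e1, e2] at h2
  rw [map_pow, kColoredCrankGF]
  have hz : qProd (1 : ℂ) ^ deltaOdd k ≠ 0 := pow_ne_zero _ (qProd_ne_zero 1)
  apply mul_left_cancel₀ hz
  set A : PowerSeries ℂ :=
    if HasOddPrimeFactorTwoModThree k then symProd ((ζ : ℂ) ^ ((h : ℤ) - 2)) else 1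
  set B : PowerSeries ℂ :=
    if HasOddPrimeFactorTwoModThree k then symProd ((ζ : ℂ) ^ (h : ℤ)) else 1
  set K := PowerSeries.map (evalLaurent ζ) (coloredCrankGF k (crankWeight k))
  set Z := qProd 1 * ∏ i ∈ Finset.range (h - 1), qProd ((ζ : ℂ) ^ (2 * (i : ℤ) + 2 - h))
  linear_combination (-K * A) * h3 - K * Z * h2 + Z * B * h1

/-- Multiplication by a power series in `q ^ ℓ` preserves the vanishing of the coefficients in
residue classes modulo `ℓ`. -/
theorem coeff_eq_zero_of_mul_expand (hℓ : ℓ.Prime) {P F : PowerSeries ℂ} {t h δ n : ℕ}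
    (hP : P * expand ℓ hℓ.ne_zero (qProd 1 ^ t) = F) (hδ : ℓ ∣ 24 * δ + h)
    (hF : ∀ N, ℓ ∣ 24 * N + h → coeff N F = 0) : coeff (ℓ * n + δ) P = 0 := by
  have hU : (qProd (1 : ℂ) ^ t) * (qProd (1 : ℂ) ^ t)⁻¹ = 1 := by
    apply PowerSeries.mul_inv_cancel
    rw [map_pow, constantCoeff_qProd, one_pow]
    exact one_ne_zero
  have hP' : P = F * expand ℓ hℓ.ne_zero (qProd 1 ^ t)⁻¹ := by
    rw [← hP, mul_assoc, ← map_mul, hU, map_one, mul_one]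
  rw [hP', coeff_mul]
  refine Finset.sum_eq_zero fun p hp => ?_
  have hp' := Finset.HasAntidiagonal.mem_antidiagonal.mp hp
  rw [coeff_expand]
  split_ifs with hd
  · rw [hF p.1, zero_mul]
    obtain ⟨j, hj⟩ := hd
    rw [hj] at hp'
    have h1 : ℓ ∣ (24 * p.1 + h) + ℓ * (24 * j) := by
      have : (24 * p.1 + h) + ℓ * (24 * j) = (24 * δ + h) + ℓ * (24 * n) := by linarith
      rw [this]
      exact dvd_add hδ (dvd_mul_right _ _)
    exact (Nat.dvd_add_left (dvd_mul_right _ _)).mp h1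
  · rw [mul_zero]

end

/-! ### The congruence -/

section

open PowerSeries

variable {ζ : ℂˣ} {ℓ : ℕ}

theorem zpow_ne_one (hζ : IsPrimitiveRoot (ζ : ℂ) ℓ) {m : ℕ} (hm : ¬ ℓ ∣ m) :
    (ζ : ℂ) ^ (m : ℤ) ≠ 1 := fun h =>
  hm (Int.natCast_dvd_natCast.mp ((hζ.zpow_eq_one_iff_dvd _).mp h))

theorem zpow_pow_eq_one (hζ : IsPrimitiveRoot (ζ : ℂ) ℓ) (m : ℤ) : ((ζ : ℂ) ^ m) ^ ℓ = 1 := by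
  rw [← zpow_natCast, ← zpow_mul, mul_comm, zpow_mul, zpow_natCast, hζ.pow_eq_one, one_zpow]

/-- Up to a power series in `q ^ ℓ`, the crank generating function at a root of unity of order `ℓ`
is one of the theta blocks whose coefficients of index `N` with `ℓ ∣ 24 N + h` vanish. For `h = 14`
and `ℓ = 5` the factor of the block with `x = ζ ^ 10` degenerates, and for `h = 26` the progression is
singular. -/
theorem exists_vanishing_block (hℓ : ℓ.Prime) (h5 : 5 ≤ ℓ) (hζ : IsPrimitiveRoot (ζ : ℂ) ℓ)
    {k h t : ℕ} (hk : 1 ≤ k) (hkh : k + h = ℓ * t) (hfam : CongruenceFamily h ℓ)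
    (hgen : ¬ IsSingularProgression k ℓ) (hex : ¬ (h = 14 ∧ ℓ = 5)) :
    ∃ F, PowerSeries.map (evalLaurent ζ) (kColoredCrankGF k) *
      expand ℓ hℓ.ne_zero (qProd 1 ^ t) = F ∧ ∀ N, ℓ ∣ 24 * N + h → coeff N F = 0 := by
  have hζ0 : (ζ : ℂ) ≠ 0 := ζ.ne_zero
  have hdvd : ℓ ∣ k + h := ⟨t, hkh⟩
  have hu := fun m : ℤ => zpow_pow_eq_one hζ m
  have hA : ∀ {a b c : ℤ}, a + b = c → (ζ : ℂ) ^ a * (ζ : ℂ) ^ b = (ζ : ℂ) ^ c := fun h => by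
    rw [← zpow_add₀ hζ0, h]
  have hS : ∀ {a b c : ℤ}, a - b = c → (ζ : ℂ) ^ a / (ζ : ℂ) ^ b = (ζ : ℂ) ^ c := fun h => by
    rw [← zpow_sub₀ hζ0, h]
  have hsq : ∀ {a b : ℤ}, a * 2 = b → ((ζ : ℂ) ^ a) ^ 2 = (ζ : ℂ) ^ b := fun h => by
    rw [← h, zpow_mul, zpow_ofNat]
  have main := map_kColoredCrankGF_mul hℓ h5 hζ hk (h := h) (t := t)
    (by rcases hfam with ⟨h | h | h, _⟩ | ⟨h | h, _⟩ | ⟨h, _⟩ <;> omega) hkh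
  have hz := fun m : ℤ => symProd_ne_zero ((ζ : ℂ) ^ m)
  have hsym : ∀ m : ℤ, qProd ((ζ : ℂ) ^ m) * qProd ((ζ : ℂ) ^ (-m)) = symProd ((ζ : ℂ) ^ m) :=
    fun m => by rw [symProd, zpow_neg]
  refine ⟨_, rfl, fun N hN => ?_⟩
  generalize PowerSeries.map (evalLaurent ζ) (kColoredCrankGF k) *
    expand ℓ hℓ.ne_zero (qProd 1 ^ t) = P at main ⊢
  rcases hfam with ⟨h | h | h, h3⟩ | ⟨h | h, h4⟩ | ⟨h, h11⟩
  · subst h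
    have hn : ∀ m : ℕ, m = 2 ∨ m = 4 → (ζ : ℂ) ^ (m : ℤ) ≠ 1 := fun m hm =>
      zpow_ne_one hζ fun hd => by
        have := Nat.le_of_dvd (by omega) hd
        omega
    have e : ∏ i ∈ Finset.range (4 - 1), qProd ((ζ : ℂ) ^ (2 * (i : ℤ) + 2 - (4 : ℕ))) =
        qProd 1 * symProd ((ζ : ℂ) ^ (2 : ℤ)) := by
      rw [← hsym]
      simp only [Finset.prod_range_succ, Finset.prod_range_zero, Nat.cast_ofNat,
        Nat.cast_zero, Nat.cast_one]
      norm_num only [zpow_zero]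
      ring
    rw [e] at main
    split_ifs at main with hodd
    · have : P = qProd 1 ^ 2 * symProd ((ζ : ℂ) ^ (4 : ℤ)) := by
        apply mul_right_cancel₀ (hz 2)
        norm_num only [Nat.cast_ofNat] at main
        linear_combination main
      rw [this]
      exact coeff_block_four hℓ h5 h3 (hu 4) (hn 4 (by simp)) hN
    · have : P = qProd 1 ^ 2 * symProd ((ζ : ℂ) ^ (2 : ℤ)) := by
        linear_combination main
      rw [this]
      exact coeff_block_four hℓ h5 h3 (hu 2) (hn 2 (by simp)) hN
  · subst h
    have h3' : ℓ % 3 = 2 := h3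
    have hn : ∀ m : ℕ, m = 2 ∨ m = 4 ∨ m = 6 → (ζ : ℂ) ^ (m : ℤ) ≠ 1 := fun m hm =>
      zpow_ne_one hζ fun hd => by
        have := Nat.le_of_dvd (by omega) hd
        have : ℓ ≤ 6 := by omega
        interval_cases ℓ <;> omega
    have e : ∏ i ∈ Finset.range (8 - 1), qProd ((ζ : ℂ) ^ (2 * (i : ℤ) + 2 - (8 : ℕ))) =
        qProd 1 * (symProd ((ζ : ℂ) ^ (2 : ℤ)) * symProd ((ζ : ℂ) ^ (4 : ℤ)) *
          symProd ((ζ : ℂ) ^ (6 : ℤ))) := by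
      rw [← hsym, ← hsym, ← hsym]
      simp only [Finset.prod_range_succ, Finset.prod_range_zero, Nat.cast_ofNat,
        Nat.cast_zero, Nat.cast_one]
      norm_num only [zpow_zero]
      ring
    rw [e, if_neg fun hodd => hgen (Or.inl ⟨hodd, h3, hdvd⟩),
      if_neg fun hodd => hgen (Or.inl ⟨hodd, h3, hdvd⟩)] at main
    have : P = qProd 1 ^ 2 * (symProd ((ζ : ℂ) ^ (2 : ℤ)) * symProd ((ζ : ℂ) ^ (4 : ℤ)) *
        symProd ((ζ : ℂ) ^ (2 : ℤ) * (ζ : ℂ) ^ (4 : ℤ))) := by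
      rw [hA (show (2 : ℤ) + 4 = 6 by norm_num)]
      linear_combination main
    rw [this]
    exact coeff_block_eight hℓ h5 h3 (hu 2) (hu 4) (hn 2 (by simp)) (hn 4 (by simp))
      (by rw [hA (show (2 : ℤ) + 4 = 6 by norm_num)]; exact hn 6 (by simp)) hN
  · subst h
    have h3' : ℓ % 3 = 2 := h3
    have hn : ∀ m : ℕ, m = 2 ∨ m = 4 ∨ m = 6 ∨ m = 8 ∨ m = 10 ∨ m = 14 →
        (ζ : ℂ) ^ (m : ℤ) ≠ 1 := fun m hm => zpow_ne_one hζ fun hd => by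
        have := Nat.le_of_dvd (by omega) hd
        have : ℓ ≤ 14 := by omega
        interval_cases ℓ <;> first | omega | (norm_num at hℓ)
    have hodd : HasOddPrimeFactorTwoModThree k :=
      ⟨ℓ, hℓ, hℓ.odd_of_ne_two (by omega), h3, hdvd⟩
    have e : ∏ i ∈ Finset.range (14 - 1), qProd ((ζ : ℂ) ^ (2 * (i : ℤ) + 2 - (14 : ℕ))) =
        qProd 1 * (symProd ((ζ : ℂ) ^ (2 : ℤ)) * symProd ((ζ : ℂ) ^ (4 : ℤ)) *
          symProd ((ζ : ℂ) ^ (6 : ℤ)) * symProd ((ζ : ℂ) ^ (8 : ℤ)) *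
          symProd ((ζ : ℂ) ^ (10 : ℤ)) * symProd ((ζ : ℂ) ^ (12 : ℤ))) := by
      rw [← hsym, ← hsym, ← hsym, ← hsym, ← hsym, ← hsym]
      simp only [Finset.prod_range_succ, Finset.prod_range_zero, Nat.cast_ofNat,
        Nat.cast_zero, Nat.cast_one]
      norm_num only [zpow_zero]
      ring
    rw [e, if_pos hodd, if_pos hodd] at main
    have m1 := hA (show (2 : ℤ) + 6 = 8 by norm_num)
    have m2 := hS (show (6 : ℤ) - 2 = 4 by norm_num)
    have m3 : ((ζ : ℂ) ^ (2 : ℤ)) ^ 2 * (ζ : ℂ) ^ (6 : ℤ) = (ζ : ℂ) ^ (10 : ℤ) := by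
      rw [hsq (show (2 : ℤ) * 2 = 4 by norm_num), hA (show (4 : ℤ) + 6 = 10 by norm_num)]
    have m4 : (ζ : ℂ) ^ (2 : ℤ) * ((ζ : ℂ) ^ (6 : ℤ)) ^ 2 = (ζ : ℂ) ^ (14 : ℤ) := by
      rw [hsq (show (6 : ℤ) * 2 = 12 by norm_num), hA (show (2 : ℤ) + 12 = 14 by norm_num)]
    have := coeff_block_fourteen hℓ h5 h3 (hu 2) (hu 6) (hn 2 (by simp)) (hn 6 (by simp))
      (by rw [m1]; exact hn 8 (by simp)) (by rw [m2]; exact hn 4 (by simp))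
      (by rw [m3]; exact hn 10 (by simp)) (by rw [m4]; exact hn 14 (by simp)) hN
    rw [m1, m2, m3, m4] at this
    rw [← this]
    congr 1
    apply mul_right_cancel₀ (hz 12)
    norm_num only [Nat.cast_ofNat] at main
    linear_combination main
  · subst h
    have h4' : ℓ % 4 = 3 := h4
    have hn : ∀ m : ℕ, m = 2 ∨ m = 4 ∨ m = 6 → (ζ : ℂ) ^ (m : ℤ) ≠ 1 := fun m hm =>
      zpow_ne_one hζ fun hd => by
        have := Nat.le_of_dvd (by omega) hd
        have : ℓ ≤ 6 := by omega
        interval_cases ℓ <;> omega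
    have e : ∏ i ∈ Finset.range (6 - 1), qProd ((ζ : ℂ) ^ (2 * (i : ℤ) + 2 - (6 : ℕ))) =
        qProd 1 * (symProd ((ζ : ℂ) ^ (2 : ℤ)) * symProd ((ζ : ℂ) ^ (4 : ℤ))) := by
      rw [← hsym, ← hsym]
      simp only [Finset.prod_range_succ, Finset.prod_range_zero, Nat.cast_ofNat,
        Nat.cast_zero, Nat.cast_one]
      norm_num only [zpow_zero]
      ring
    rw [e] at main
    split_ifs at main with hodd
    · have : P = qProd 1 ^ 2 * (symProd ((ζ : ℂ) ^ (2 : ℤ)) * symProd ((ζ : ℂ) ^ (6 : ℤ))) := by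
        apply mul_right_cancel₀ (hz 4)
        norm_num only [Nat.cast_ofNat] at main
        linear_combination main
      rw [this]
      exact coeff_block_six hℓ h5 h4 (hu 2) (hu 6) (hn 2 (by simp)) (hn 6 (by simp)) hN
    · have : P = qProd 1 ^ 2 * (symProd ((ζ : ℂ) ^ (2 : ℤ)) * symProd ((ζ : ℂ) ^ (4 : ℤ))) := by
        linear_combination main
      rw [this]
      exact coeff_block_six hℓ h5 h4 (hu 2) (hu 4) (hn 2 (by simp)) (hn 4 (by simp)) hN
  · subst h
    have h4' : ℓ % 4 = 3 := h4
    have hn : ∀ m : ℕ, m = 2 ∨ m = 4 ∨ m = 6 ∨ m = 8 ∨ m = 10 →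
        (ζ : ℂ) ^ (m : ℤ) ≠ 1 := fun m hm => zpow_ne_one hζ fun hd => by
        have := Nat.le_of_dvd (by omega) hd
        have : ℓ ≤ 10 := by omega
        interval_cases ℓ <;> omega
    have e : ∏ i ∈ Finset.range (10 - 1), qProd ((ζ : ℂ) ^ (2 * (i : ℤ) + 2 - (10 : ℕ))) =
        qProd 1 * (symProd ((ζ : ℂ) ^ (2 : ℤ)) * symProd ((ζ : ℂ) ^ (4 : ℤ)) *
          symProd ((ζ : ℂ) ^ (6 : ℤ)) * symProd ((ζ : ℂ) ^ (8 : ℤ))) := by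
      rw [← hsym, ← hsym, ← hsym, ← hsym]
      simp only [Finset.prod_range_succ, Finset.prod_range_zero, Nat.cast_ofNat,
        Nat.cast_zero, Nat.cast_one]
      norm_num only [zpow_zero]
      ring
    rw [e] at main
    split_ifs at main with hodd
    · have m1 := hA (show (6 : ℤ) + 4 = 10 by norm_num)
      have m2 := hS (show (6 : ℤ) - 4 = 2 by norm_num)
      have := coeff_block_ten hℓ h5 h4 (hu 6) (hu 4) (hn 6 (by simp)) (hn 4 (by simp))
        (by rw [m1]; exact hn 10 (by simp)) (by rw [m2]; exact hn 2 (by simp)) hN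
      rw [m1, m2] at this
      rw [← this]
      congr 1
      apply mul_right_cancel₀ (hz 8)
      norm_num only [Nat.cast_ofNat] at main
      linear_combination main
    · have m1 := hA (show (6 : ℤ) + 2 = 8 by norm_num)
      have m2 := hS (show (6 : ℤ) - 2 = 4 by norm_num)
      have := coeff_block_ten hℓ h5 h4 (hu 6) (hu 2) (hn 6 (by simp)) (hn 2 (by simp))
        (by rw [m1]; exact hn 8 (by simp)) (by rw [m2]; exact hn 4 (by simp)) hN
      rw [m1, m2] at this
      rw [← this]
      congr 1
      linear_combination main
  · subst h
    exact absurd (Or.inr ⟨h11, hdvd⟩) hgen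

end

theorem theorem1p3 (k h ℓ t δ : ℕ) (hk : 1 ≤ k) (hℓ : ℓ.Prime) (hℓ5 : 5 ≤ ℓ)
    (hkh : k + h = ℓ * t) (hfam : CongruenceFamily h ℓ)
    (hδ : 24 * δ ≡ k [MOD ℓ]) (hgen : ¬ IsSingularProgression k ℓ) (n : ℕ) :
    Polynomial.toLaurent (Polynomial.cyclotomic ℓ ℤ) ∣
      PowerSeries.coeff (ℓ * n + δ) (kColoredCrankGF k) := by
  have hroot := Complex.isPrimitiveRoot_exp ℓ hℓ.ne_zero
  obtain ⟨ζ, hζu⟩ := hroot.isUnit hℓ.ne_zero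
  rw [← hζu] at hroot
  apply cyclotomic_dvd_of_evalLaurent_eq_zero hℓ.pos hroot
  rw [← PowerSeries.coeff_map]
  have hδh : ∀ h' : ℕ, ℓ ∣ k + h' → ℓ ∣ 24 * δ + h' := fun h' hd =>
    (Nat.modEq_zero_iff_dvd.mp ((hδ.add_right h').trans (Nat.modEq_zero_iff_dvd.mpr hd)))
  by_cases hex : h = 14 ∧ ℓ = 5
  · -- modulo `5` the pairs `(14, 5)` and `(4, 5)` describe the same progressions
    obtain ⟨rfl, rfl⟩ := hex
    obtain ⟨F, hF, hF'⟩ := exists_vanishing_block hℓ hℓ5 hroot hk (h := 4) (t := t - 2) (by omega)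
      (Or.inl ⟨Or.inl rfl, rfl⟩) hgen (by omega)
    exact coeff_eq_zero_of_mul_expand hℓ hF (hδh 4 ⟨t - 2, by omega⟩) hF'
  · obtain ⟨F, hF, hF'⟩ := exists_vanishing_block hℓ hℓ5 hroot hk hkh hfam hgen hex
    exact coeff_eq_zero_of_mul_expand hℓ hF (hδh h ⟨t, hkh⟩) hF'
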